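/- **Theorem 3.8.** Let $\Bbbk$ be a field. All operads are symmetric operads over $\Bbbk$ with components $\mathcal P(n)$, $n\ge 0$, and an isomorphism of operads is a family of linear isomorphisms $\mathcal P(n)\to\mathcal Q(n)$ compatible with the identity $\mathbf 1\in\mathcal P(1)$, the $\mathbb S_n$-actions and the partial compositions $\circ_i$. Let $\mathcal{A}s$, $\mathcal{C}om$ and $\mathcal{P}ois$ be the operads of unital associative algebras, of unital commutative algebras and of unital commutative Poisson algebras: $\mathcal{A}s(n)=\Bbbk\mathbb S_n$, $\mathcal{C}om(n)=\Bbbk$, and $\mathcal{P}ois$ is generated by $\mathbf 1_0$ (arity $0$), $\mathbf 1_2$ and $\tau$ (arity $2$) subject to $$\mathbf 1_2\circ_1\mathbf 1_0=\mathbf 1_2\circ_2\mathbf 1_0=\mathbf 1,\quad \tau\circ_1\mathbf 1_0=\tau\circ_2\mathbf 1_0=0,\quad \mathbf 1_2*(12)=\mathbf 1_2,\quad \tau*(12)=-\tau,\quad \mathbf 1_2\circ_1\mathbf 1_2=\mathbf 1_2\circ_2\mathbf 1_2,$$ $$\tau\circ_1\mathbf 1_2=\mathbf 1_2\circ_2\tau+(\mathbf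 1_2\circ_2\tau)*(12),\qquad \tau\circ_2\tau=\tau\circ_1\tau+(\tau\circ_2\tau)*(12).$$ For an operad $\mathcal P$ with $\mathcal P(0)=\Bbbk\mathbf 1_0\cong\Bbbk$ and $I\subseteq\{1,\dots,n\}$, let $\pi^I:\mathcal P(n)\to\mathcal P(|I|)$ be the map that inserts $\mathbf 1_0$ in every slot not in $I$ (and the identity $\mathbf 1$ in the slots in $I$). For $k\ge 1$ the $k$-th truncation ideal ${}^k\mathcal I={}^k\mathcal I_{\mathcal P}$ of $\mathcal P$ is given by ${}^k\mathcal I(n)=\bigcap_{|I|=k-1}\ker\pi^I$ if $n\ge k$ and ${}^k\mathcal I(n)=0$ if $n<k$. In $\mathcal{A}s/{}^k\mathcal I$ and $\mathcal{P}ois/{}^k\mathcal I$, the ideal ${}^k\mathcal I$ is that of $\mathcal{A}s$, respectively of $\mathcal{P}ois$. A derivation of $\mathcal P$ is a family $\partial$ of $\mathbb S_n$-equivariant linear maps $\mathcal P(n)\to\mathcal P(n)$ with $\partial(\mu\circ_i\nu)=\partial(\mu)\circ_i\nu+\mu\circ_i\partial(\nu)$; it is inner if for some $\lambda\in\mathcal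 P(1)$ one has $\partial(\theta)=\lambda\circ_1\theta-\sum_{i=1}^n\theta\circ_i\lambda$ for all $n$ and all $\theta\in\mathcal P(n)$; and $H^1(\mathcal P)$ is the $\Bbbk$-space of derivations modulo inner derivations. 1. $\mathcal{A}s/{}^1\mathcal I\cong\mathcal{P}ois/{}^1\mathcal I\cong\mathcal{A}s/{}^2\mathcal I\cong\mathcal{P}ois/{}^2\mathcal I\cong\mathcal{C}om$, and $H^1(\mathcal P)=0$ for each of these operads $\mathcal P$. 2. If $\operatorname{char}\Bbbk\ne 2$, then $\mathcal{A}s/{}^3\mathcal I\cong\mathcal{P}ois/{}^3\mathcal I$, and $H^1(\mathcal P)\cong\Bbbk$ for each of these two operads $\mathcal P$. 3. If $\operatorname{char}\Bbbk=2$, then $\mathcal{A}s/{}^3\mathcal I\not\cong\mathcal{P}ois/{}^3\mathcal I$. 4. For every $k\ge 4$, $\mathcal{A}s/{}^k\mathcal I\not\cong\mathcal{P}ois/{}^k\mathcal I$. -/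

import Mathlib

universe u

namespace Operadic
/-- Where an index `a ≠ i` goes when slot `i` is replaced by a block of `n` slots. -/
def shift (i n a : ℕ) : ℕ := if a < i then a else a + n - 1

/-- The slot in `Fin r`, `r = m + n - 1`, of an index `a ≠ i` of `Fin m` after replacing slot `i`
of `Fin m` by a block of `n` slots. -/
def outerPos {m n r : ℕ} (h : m + n = r + 1) (i a : Fin m) (ha : a ≠ i) : Fin r :=
  ⟨shift i n a, by have := Fin.val_ne_of_ne ha; unfold shift; split_ifs <;> omega⟩

/-- The slot in `Fin r`, `r = m + n - 1`, of an index `b` of the block of `n` slots replacing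
slot `i` of `Fin m`. -/
def innerPos {m n r : ℕ} (h : m + n = r + 1) (i : Fin m) (b : Fin n) : Fin r :=
  ⟨i + b, by omega⟩

theorem outerPos_val {m n r : ℕ} (h : m + n = r + 1) (i a : Fin m) (ha : a ≠ i) :
    (outerPos h i a ha).1 = shift i.1 n a.1 := rfl

theorem innerPos_val {m n r : ℕ} (h : m + n = r + 1) (i : Fin m) (b : Fin n) :
    (innerPos h i b).1 = i.1 + b.1 := rfl

/-- The slots after replacing slot `i` of `Fin m` by a block of `n` slots. -/
noncomputable def blockEquiv {m n r : ℕ} (h : m + n = r + 1) (i : Fin m) :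
    {a : Fin m // a ≠ i} ⊕ Fin n ≃ Fin r :=
  Equiv.ofBijective (Sum.elim (fun a => outerPos h i a.1 a.2) (innerPos h i)) (by
    constructor
    · rintro (⟨a, ha⟩ | b) (⟨a', ha'⟩ | b') hab
      all_goals
        have hv := congrArg Fin.val hab
        simp only [Sum.elim_inl, Sum.elim_inr, outerPos_val, innerPos_val] at hv
      · have h1 := Fin.val_ne_of_ne ha
        have h2 := Fin.val_ne_of_ne ha'
        have : a = a' := by
          ext; unfold shift at hv; split_ifs at hv <;> omega
        subst this; rfl
      · have h1 := Fin.val_ne_of_ne ha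
        unfold shift at hv; split_ifs at hv <;> omega
      · have h1 := Fin.val_ne_of_ne ha'
        unfold shift at hv; split_ifs at hv <;> omega
      · have : b = b' := by ext; omega
        rw [this]
    · intro x
      by_cases h1 : x.1 < i.1
      · refine ⟨Sum.inl ⟨⟨x, by omega⟩, fun e => ?_⟩, ?_⟩
        · have := congrArg Fin.val e; simp at this; omega
        · ext; simp [outerPos_val, shift, h1]
      · by_cases h2 : x.1 < i.1 + n
        · refine ⟨Sum.inr ⟨x - i, by omega⟩, ?_⟩
          ext; simp [innerPos_val]; omega
        · refine ⟨Sum.inl ⟨⟨x + 1 - n, by omega⟩, fun e => ?_⟩, ?_⟩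
          · have := congrArg Fin.val e; simp at this; omega
          · ext; simp only [Sum.elim_inl, outerPos_val, shift]; split_ifs <;> omega)

/-- The partial composition `φ ∘ᵢ σ` of permutations. Here `φ a` is the position of the variable
`a` in the word encoded by `φ`, and in the word of `φ ∘ᵢ σ` the variable `i` of the word of `φ` is
replaced by the word of `σ` (and the variables are renumbered in order). -/
noncomputable def permComp {m n r : ℕ} (h : m + n = r + 1) (i : Fin m) (φ : Equiv.Perm (Fin m))
    (σ : Equiv.Perm (Fin n)) : Equiv.Perm (Fin r) :=
  ((blockEquiv h i).symm.trans
    (Equiv.sumCongr (φ.subtypeEquiv fun _ => φ.injective.ne_iff.symm) σ)).trans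
      (blockEquiv h (φ i))

theorem permComp_outer {m n r : ℕ} (h : m + n = r + 1) (i : Fin m) (φ : Equiv.Perm (Fin m))
    (σ : Equiv.Perm (Fin n)) (a : Fin m) (ha : a ≠ i) :
    permComp h i φ σ (outerPos h i a ha) = outerPos h (φ i) (φ a) (φ.injective.ne ha) := by
  have : (blockEquiv h i).symm (outerPos h i a ha) = Sum.inl ⟨a, ha⟩ := by
    rw [Equiv.symm_apply_eq]; rfl
  simp only [permComp, Equiv.trans_apply, this]; rfl

theorem permComp_inner {m n r : ℕ} (h : m + n = r + 1) (i : Fin m) (φ : Equiv.Perm (Fin m))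
    (σ : Equiv.Perm (Fin n)) (b : Fin n) :
    permComp h i φ σ (innerPos h i b) = innerPos h (φ i) (σ b) := by
  have : (blockEquiv h i).symm (innerPos h i b) = Sum.inr b := by
    rw [Equiv.symm_apply_eq]; rfl
  simp only [permComp, Equiv.trans_apply, this]; rfl

theorem pos_cases {m n r : ℕ} (h : m + n = r + 1) (i : Fin m) (x : Fin r) :
    (∃ a ha, x = outerPos h i a ha) ∨ ∃ b, x = innerPos h i b := by
  obtain ⟨y | b, rfl⟩ := (blockEquiv h i).surjective x
  · exact Or.inl ⟨y.1, y.2, rfl⟩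
  · exact Or.inr ⟨b, rfl⟩

theorem permComp_outer' {m n r : ℕ} (h : m + n = r + 1) {i : Fin m} (φ : Equiv.Perm (Fin m))
    (σ : Equiv.Perm (Fin n)) {x : Fin r} (a : Fin m) (ha : a ≠ i)
    (hx : x.1 = shift i.1 n a.1) :
    (permComp h i φ σ x).1 = shift (φ i).1 n (φ a).1 := by
  have : x = outerPos h i a ha := Fin.ext (by rw [hx, outerPos_val])
  rw [this, permComp_outer, outerPos_val]

theorem permComp_inner' {m n r : ℕ} (h : m + n = r + 1) {i : Fin m} (φ : Equiv.Perm (Fin m))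
    (σ : Equiv.Perm (Fin n)) {x : Fin r} (b : Fin n) (hx : x.1 = i.1 + b.1) :
    (permComp h i φ σ x).1 = (φ i).1 + (σ b).1 := by
  have : x = innerPos h i b := Fin.ext hx
  rw [this, permComp_inner, innerPos_val]

theorem permComp_mul {m n r : ℕ} (h : m + n = r + 1) (i : Fin m) (φ ψ : Equiv.Perm (Fin m))
    (σ τ : Equiv.Perm (Fin n)) :
    permComp h i (φ * ψ) (σ * τ) = permComp h (ψ i) φ σ * permComp h i ψ τ := by
  ext1 x
  rcases pos_cases h i x with ⟨a, ha, rfl⟩ | ⟨b, rfl⟩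
  · rw [Equiv.Perm.mul_apply, permComp_outer, permComp_outer, permComp_outer]; rfl
  · rw [Equiv.Perm.mul_apply, permComp_inner, permComp_inner, permComp_inner]; rfl

theorem permComp_one_right {m : ℕ} (i : Fin m) (φ : Equiv.Perm (Fin m)) :
    permComp (n := 1) rfl i φ 1 = φ := by
  ext x
  by_cases hx : x = i
  · subst hx
    rw [permComp_inner' _ _ _ 0 (by simp)]; simp
  · rw [permComp_outer' _ _ _ x hx (by simp [shift])]; simp [shift]

theorem permComp_one_left {n : ℕ} (h : 1 + n = n + 1) (σ : Equiv.Perm (Fin n)) :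
    permComp h 0 1 σ = σ := by
  ext x
  rw [permComp_inner' _ _ _ x (by simp)]; simp

theorem permComp_assoc {l m n p q r : ℕ} (hp : l + m = p + 1) (hr : p + n = r + 1)
    (hq : m + n = q + 1) (hr' : l + q = r + 1) (i : Fin l) (j : Fin m)
    (φ : Equiv.Perm (Fin l)) (σ : Equiv.Perm (Fin m)) (τ : Equiv.Perm (Fin n)) :
    permComp hr ⟨i + j, by omega⟩ (permComp hp i φ σ) τ =
      permComp hr' i φ (permComp hq j σ τ) := by
  have hij : (permComp hp i φ σ ⟨i + j, by omega⟩).1 = φ i + σ j :=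
    permComp_inner' _ _ _ j rfl
  ext x
  rcases pos_cases hr ⟨i + j, by omega⟩ x with ⟨y, hy, rfl⟩ | ⟨c, rfl⟩
  · have hy' := Fin.val_ne_of_ne hy
    rw [permComp_outer' hr _ _ y hy (outerPos_val ..), hij]
    rcases pos_cases hp i y with ⟨a, ha, rfl⟩ | ⟨b, rfl⟩
    · have ha' := Fin.val_ne_of_ne ha
      have hφ := Fin.val_ne_of_ne (φ.injective.ne ha)
      rw [permComp_outer, outerPos_val]
      rw [permComp_outer' hr' φ _ a ha]
      · unfold shift; split_ifs <;> omega
      · simp only [outerPos_val]; unfold shift; split_ifs <;> omega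
    · have hb : b ≠ j := by rintro rfl; exact hy rfl
      rw [permComp_inner, innerPos_val]
      have := Fin.val_ne_of_ne hb
      have hσ := Fin.val_ne_of_ne (σ.injective.ne hb)
      rw [permComp_inner' hr' φ _ (outerPos hq j b hb), permComp_outer, outerPos_val]
      · unfold shift; split_ifs <;> omega
      · simp only [outerPos_val, innerPos_val]; unfold shift; split_ifs <;> omega
  · rw [permComp_inner, innerPos_val, hij,
      permComp_inner' hr' φ _ (innerPos hq j c), permComp_inner, innerPos_val]
    · omega
    · simp only [innerPos_val]; omega

theorem permComp_comm {l m n p q r : ℕ} (hp : l + m = p + 1) (hr : p + n = r + 1)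
    (hq : l + n = q + 1) (hr' : q + m = r + 1) (i j : Fin l) (hij : i < j)
    (φ : Equiv.Perm (Fin l)) (σ : Equiv.Perm (Fin m)) (τ : Equiv.Perm (Fin n)) :
    permComp hr ⟨j + m - 1, by omega⟩ (permComp hp i φ σ) τ =
      permComp hr' ⟨i, by omega⟩ (permComp hq j φ τ) σ := by
  have hij' : i.1 < j.1 := hij
  have hji : j ≠ i := ne_of_gt hij
  have hne := Fin.val_ne_of_ne (φ.injective.ne hji)
  have e1 := permComp_outer' hp φ σ (x := ⟨j + m - 1, by omega⟩) j hji
    (by dsimp only; unfold shift; split_ifs <;> omega)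
  have e2 := permComp_outer' hq φ τ (x := ⟨i, by omega⟩) i hji.symm
    (by simp only [shift, if_pos hij'])
  ext x
  rcases pos_cases hr ⟨j + m - 1, by omega⟩ x with ⟨y, hy, rfl⟩ | ⟨c, rfl⟩
  · have hy' := Fin.val_ne_of_ne hy
    rw [permComp_outer' hr _ _ y hy (outerPos_val ..), e1]
    rcases pos_cases hp i y with ⟨a, ha, rfl⟩ | ⟨b, rfl⟩
    · have ha' := Fin.val_ne_of_ne ha
      have haj : a ≠ j := by
        rintro rfl; apply hy; ext; simp only [outerPos_val]; unfold shift; split_ifs <;> omega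
      have haj' := Fin.val_ne_of_ne haj
      have hφ := Fin.val_ne_of_ne (φ.injective.ne ha)
      have hφ' := Fin.val_ne_of_ne (φ.injective.ne haj)
      rw [permComp_outer, outerPos_val]
      rw [permComp_outer' hr' _ σ (outerPos hq j a haj), permComp_outer, outerPos_val, e2]
      · unfold shift; split_ifs <;> omega
      · intro e; have := congrArg Fin.val e
        simp only [outerPos_val] at this; unfold shift at this; split_ifs at this <;> omega
      · simp only [outerPos_val]; unfold shift; split_ifs <;> omega
    · rw [permComp_inner, innerPos_val, permComp_inner' hr' _ σ b, e2]
      · unfold shift; split_ifs <;> omega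
      · simp only [outerPos_val, innerPos_val]; unfold shift; split_ifs <;> omega
  · rw [permComp_inner, innerPos_val, e1]
    rw [permComp_outer' hr' _ σ (innerPos hq j c), permComp_inner, innerPos_val, e2]
    · unfold shift; split_ifs <;> omega
    · intro e; have := congrArg Fin.val e
      simp only [innerPos_val] at this; omega
    · simp only [innerPos_val]; unfold shift; split_ifs <;> omega

/-! ### Operads, by partial compositions

Slots are numbered from `0`. The arity `m + n - 1` of a partial composition is carried as a variable
`r` with a proof of `m + n = r + 1`, so that no transport between types is needed. -/

/-- A symmetric operad over `𝕜` (partial definition). -/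
structure Operad (𝕜 : Type u) [CommRing 𝕜] where
  /-- the module of operations of arity `n` -/
  obj : ℕ → Type u
  [grp : ∀ n, AddCommGroup (obj n)]
  [mod : ∀ n, Module 𝕜 (obj n)]
  /-- the right action of the symmetric group: `act σ θ` is `θ * σ` -/
  act : ∀ {n : ℕ}, Equiv.Perm (Fin n) → obj n →ₗ[𝕜] obj n
  /-- the identity operation -/
  one : obj 1
  /-- the partial composition: `comp h i μ ν` is `μ ∘ᵢ ν` -/
  comp : ∀ {m n r : ℕ}, m + n = r + 1 → Fin m → obj m →ₗ[𝕜] obj n →ₗ[𝕜] obj r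
  act_one : ∀ {n : ℕ} (θ : obj n), act 1 θ = θ
  act_mul : ∀ {n : ℕ} (σ τ : Equiv.Perm (Fin n)) (θ : obj n), act (σ * τ) θ = act τ (act σ θ)
  comp_one : ∀ {n : ℕ} (i : Fin n) (θ : obj n), comp rfl i θ one = θ
  one_comp : ∀ {n : ℕ} (h : 1 + n = n + 1) (θ : obj n), comp h 0 one θ = θ
  comp_assoc : ∀ {l m n p q r : ℕ} (hp : l + m = p + 1) (hr : p + n = r + 1)
    (hq : m + n = q + 1) (hr' : l + q = r + 1) (i : Fin l) (j : Fin m)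
    (a : obj l) (b : obj m) (c : obj n),
    comp hr ⟨i + j, by omega⟩ (comp hp i a b) c = comp hr' i a (comp hq j b c)
  comp_comm : ∀ {l m n p q r : ℕ} (hp : l + m = p + 1) (hr : p + n = r + 1)
    (hq : l + n = q + 1) (hr' : q + m = r + 1) (i j : Fin l) (_ : i < j)
    (a : obj l) (b : obj m) (c : obj n),
    comp hr ⟨j + m - 1, by omega⟩ (comp hp i a b) c = comp hr' ⟨i, by omega⟩ (comp hq j a c) b
  comp_act : ∀ {m n r : ℕ} (h : m + n = r + 1) (i : Fin m) (μ : obj m) (ν : obj n)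
    (σ : Equiv.Perm (Fin n)), comp h i μ (act σ ν) = act (permComp h i 1 σ) (comp h i μ ν)
  act_comp : ∀ {m n r : ℕ} (h : m + n = r + 1) (i : Fin m) (μ : obj m) (ν : obj n)
    (φ : Equiv.Perm (Fin m)), comp h i (act φ μ) ν = act (permComp h i φ 1) (comp h (φ i) μ ν)

attribute [instance] Operad.grp Operad.mod

/-- A unitary operad: `P(0)` is free of rank one on the chosen element `unit0`. -/
structure UnitaryOperad (𝕜 : Type u) [CommRing 𝕜] extends Operad 𝕜 where
  unit0 : obj 0
  unit0_basis : Function.Bijective fun c : 𝕜 => c • unit0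

/-- Morphisms of operads. -/
structure OperadHom {𝕜 : Type u} [CommRing 𝕜] (P Q : Operad 𝕜) where
  toFun : ∀ n, P.obj n →ₗ[𝕜] Q.obj n
  map_one : toFun 1 P.one = Q.one
  map_act : ∀ {n : ℕ} (σ : Equiv.Perm (Fin n)) (θ : P.obj n),
    toFun n (P.act σ θ) = Q.act σ (toFun n θ)
  map_comp : ∀ {m n r : ℕ} (h : m + n = r + 1) (i : Fin m) (μ : P.obj m) (ν : P.obj n),
    toFun r (P.comp h i μ ν) = Q.comp h i (toFun m μ) (toFun n ν)

/-- Two operads are isomorphic if there is a morphism between them that is bijective in every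
arity. -/
def OperadIso {𝕜 : Type u} [CommRing 𝕜] (P Q : Operad 𝕜) : Prop :=
  ∃ f : OperadHom P Q, ∀ n, Function.Bijective (f.toFun n)

namespace Operad

variable {𝕜 : Type u} [CommRing 𝕜]

/-! ### Derivations and the first cohomology group -/

/-- The module of derivations of an operad, inside the families of linear maps. -/
def der (P : Operad 𝕜) : Submodule 𝕜 (∀ n, P.obj n →ₗ[𝕜] P.obj n) where
  carrier := {d | (∀ (n : ℕ) (σ : Equiv.Perm (Fin n)) (θ : P.obj n),
      d n (P.act σ θ) = P.act σ (d n θ)) ∧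
    ∀ (m n r : ℕ) (h : m + n = r + 1) (i : Fin m) (μ : P.obj m) (ν : P.obj n),
      d r (P.comp h i μ ν) = P.comp h i (d m μ) ν + P.comp h i μ (d n ν)}
  zero_mem' := by constructor <;> intros <;> simp
  add_mem' := by
    rintro d e ⟨hd, hd'⟩ ⟨he, he'⟩
    refine ⟨fun n σ θ => ?_, fun m n r h i μ ν => ?_⟩
    · simp [hd, he]
    · simp only [Pi.add_apply, LinearMap.add_apply, hd', he', map_add]; abel
  smul_mem' := by
    rintro c d ⟨hd, hd'⟩
    refine ⟨fun n σ θ => ?_, fun m n r h i μ ν => ?_⟩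
    · simp [hd]
    · simp [hd']

/-- The inner derivations: those of the form `θ ↦ a ∘₁ θ - ∑ᵢ θ ∘ᵢ a` with `a` in `P(1)`. -/
def innerDer (P : Operad 𝕜) : Submodule 𝕜 P.der where
  carrier := {d | ∃ a : P.obj 1, ∀ (n : ℕ) (θ : P.obj n),
    d.1 n θ = P.comp (Nat.add_comm 1 n) 0 a θ - ∑ i : Fin n, P.comp rfl i θ a}
  zero_mem' := ⟨0, fun n θ => by simp⟩
  add_mem' := by
    rintro d e ⟨a, ha⟩ ⟨b, hb⟩
    refine ⟨a + b, fun n θ => ?_⟩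
    simp only [Submodule.coe_add, Pi.add_apply, LinearMap.add_apply, ha, hb, map_add,
      Finset.sum_add_distrib]
    abel
  smul_mem' := by
    rintro c d ⟨a, ha⟩
    refine ⟨c • a, fun n θ => ?_⟩
    simp [ha, Finset.smul_sum, smul_sub]

/-- The first cohomology group `H¹(P)`: derivations modulo inner derivations. -/
abbrev H1 (P : Operad 𝕜) : Type u := P.der ⧸ P.innerDer

/-! ### Ideals and quotients -/

/-- An operadic ideal. -/
structure OpIdeal (P : Operad 𝕜) where
  carrier : ∀ n, Submodule 𝕜 (P.obj n)
  act_mem : ∀ {n : ℕ} (σ : Equiv.Perm (Fin n)) (θ : P.obj n),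
    θ ∈ carrier n → P.act σ θ ∈ carrier n
  comp_mem_left : ∀ {m n r : ℕ} (h : m + n = r + 1) (i : Fin m) (μ : P.obj m) (ν : P.obj n),
    μ ∈ carrier m → P.comp h i μ ν ∈ carrier r
  comp_mem_right : ∀ {m n r : ℕ} (h : m + n = r + 1) (i : Fin m) (μ : P.obj m) (ν : P.obj n),
    ν ∈ carrier n → P.comp h i μ ν ∈ carrier r

/-- The quotient operad `P/I`. -/
def quotient (P : Operad 𝕜) (I : P.OpIdeal) : Operad 𝕜 where
  obj n := P.obj n ⧸ I.carrier n
  act {n} σ := (I.carrier n).mapQ (I.carrier n) (P.act σ) fun θ hθ => I.act_mem σ θ hθ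
  one := Submodule.Quotient.mk P.one
  comp {m n r} h i := (I.carrier m).liftQ
    { toFun := fun μ => (I.carrier n).mapQ (I.carrier r) (P.comp h i μ)
        fun ν hν => I.comp_mem_right h i μ ν hν
      map_add' := fun μ μ' => by ext ν; simp
      map_smul' := fun c μ => by ext ν; simp }
    (fun μ hμ => by
      rw [LinearMap.mem_ker]
      ext ν
      simpa using I.comp_mem_left h i μ ν hμ)
  act_one {n} θ := by
    induction θ using Submodule.Quotient.induction_on with | _ θ
    simp [P.act_one]
  act_mul {n} σ τ θ := by
    induction θ using Submodule.Quotient.induction_on with | _ θ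
    simp [P.act_mul]
  comp_one {n} i θ := by
    induction θ using Submodule.Quotient.induction_on with | _ θ
    simp [P.comp_one]
  one_comp {n} h θ := by
    induction θ using Submodule.Quotient.induction_on with | _ θ
    simp [P.one_comp]
  comp_assoc {l m n p q r} hp hr hq hr' i j a b c := by
    induction a using Submodule.Quotient.induction_on with | _ a
    induction b using Submodule.Quotient.induction_on with | _ b
    induction c using Submodule.Quotient.induction_on with | _ c
    simp [P.comp_assoc hp hr hq hr']
  comp_comm {l m n p q r} hp hr hq hr' i j hij a b c := by
    induction a using Submodule.Quotient.induction_on with | _ a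
    induction b using Submodule.Quotient.induction_on with | _ b
    induction c using Submodule.Quotient.induction_on with | _ c
    simp [P.comp_comm hp hr hq hr' i j hij]
  comp_act {m n r} h i μ ν σ := by
    induction μ using Submodule.Quotient.induction_on with | _ μ
    induction ν using Submodule.Quotient.induction_on with | _ ν
    simp [P.comp_act]
  act_comp {m n r} h i μ ν φ := by
    induction μ using Submodule.Quotient.induction_on with | _ μ
    induction ν using Submodule.Quotient.induction_on with | _ ν
    simp [P.act_comp]

/-! ### Total compositions -/

/-- Composition of `θ ∈ P(n + s)` with `ν 0, …, ν (n - 1)` in the first `n` slots (and with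
identities in the last `s` slots), filling the slots from the last to the first. For `s = 0` this is
the total composition `θ ∘ (ν 0, …, ν (n - 1))`. In the base case the composition with the identity
only adjusts the expression for the arity. -/
def totalComp (P : Operad 𝕜) : ∀ (n s : ℕ) {r : ℕ} (a : Fin n → ℕ) (_ : ∀ i, P.obj (a i))
    (_ : (∑ i, a i) + s = r), P.obj (n + s) →ₗ[𝕜] P.obj r
  | 0, s, r, a, _, h => P.comp (m := 1) (n := 0 + s) (r := r) (by simp at h; omega) 0 P.one
  | n + 1, s, r, a, ν, h =>
    (P.totalComp n (a (Fin.last n) + s) (fun i => a i.castSucc) (fun i => ν i.castSucc)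
      (by rw [Fin.sum_univ_castSucc] at h; omega)) ∘ₗ
    (P.comp (m := n + 1 + s) (n := a (Fin.last n)) (r := n + (a (Fin.last n) + s)) (by omega)
      ⟨n, by omega⟩).flip (ν (Fin.last n))

end Operad

namespace UnitaryOperad

variable {𝕜 : Type u} [CommRing 𝕜]

/-! ### Truncation ideals of unitary operads -/

/-- `1_χ`: the identity for `true`, the `0`-unit for `false`. -/
def unitOf (P : UnitaryOperad 𝕜) : ∀ b : Bool, P.obj b.toNat
  | true => P.one
  | false => P.unit0

theorem sum_toNat {n : ℕ} (I : Finset (Fin n)) :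
    (∑ i, (decide (i ∈ I)).toNat) + 0 = I.card := by
  simp [Bool.toNat, Bool.cond_decide]

/-- The restriction operator `π^I : P(n) → P(|I|)`, `θ ↦ θ ∘ (1_{χ_I(1)}, …, 1_{χ_I(n)})`. -/
def restrict (P : UnitaryOperad 𝕜) {n : ℕ} (I : Finset (Fin n)) :
    P.obj n →ₗ[𝕜] P.obj I.card :=
  P.totalComp n 0 (fun i => (decide (i ∈ I)).toNat) (fun i => P.unitOf (decide (i ∈ I)))
    (sum_toNat I)

/-- The modules of the `k`-th truncation ideal: `0` in arities `n < k`, and for `n ≥ k` the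
intersection of the kernels of all `π^I` with `|I| = k - 1`. For `k = 0` this is everything. -/
def truncSubmodule (P : UnitaryOperad 𝕜) (k n : ℕ) : Submodule 𝕜 (P.obj n) :=
  if n < k then ⊥
  else ⨅ (I : Finset (Fin n)) (_ : I.card + 1 = k), LinearMap.ker (P.restrict I)

/-- A recursive description of the same modules, used to show that they form an ideal. -/
def truncRec (P : UnitaryOperad 𝕜) (k : ℕ) : ∀ n, Submodule 𝕜 (P.obj n)
  | 0 => if 0 < k then ⊥ else ⊤
  | n + 1 => if n + 1 < k then ⊥ else
      ⨅ i : Fin (n + 1), (truncRec P k n).comap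
        ((P.comp (m := n + 1) (n := 0) (r := n) rfl i).flip P.unit0)

theorem truncRec_lt (P : UnitaryOperad 𝕜) {k n : ℕ} (h : n < k) : P.truncRec k n = ⊥ := by
  cases n <;> simp [truncRec, h]

theorem mem_truncRec (P : UnitaryOperad 𝕜) {k n m : ℕ} (h : m + 0 = n + 1) (hk : k ≤ m)
    (θ : P.obj m) :
    θ ∈ P.truncRec k m ↔ ∀ i, P.comp h i θ P.unit0 ∈ P.truncRec k n := by
  obtain rfl : m = n + 1 := h
  simp [truncRec, not_lt.mpr hk]

theorem truncRec_zero (P : UnitaryOperad 𝕜) (n : ℕ) : P.truncRec 0 n = ⊤ := by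
  induction n with
  | zero => simp [truncRec]
  | succ n ih => simp [truncRec, ih]

theorem truncRec_act (P : UnitaryOperad 𝕜) (k : ℕ) {n : ℕ} (σ : Equiv.Perm (Fin n))
    (θ : P.obj n) (hθ : θ ∈ P.truncRec k n) : P.act σ θ ∈ P.truncRec k n := by
  induction n with
  | zero => rwa [Subsingleton.elim σ 1, P.act_one]
  | succ n ih =>
    by_cases hk : n + 1 < k
    · rw [truncRec_lt P hk, Submodule.mem_bot] at *
      rw [hθ, map_zero]
    · rw [mem_truncRec P rfl (not_lt.mp hk)] at *
      intro i
      rw [P.act_comp]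
      exact ih _ _ (hθ _)

theorem truncRec_comp_right (P : UnitaryOperad 𝕜) (k : ℕ) : ∀ {r m n : ℕ} (h : m + n = r + 1)
    (i : Fin m) (μ : P.obj m) (ν : P.obj n), ν ∈ P.truncRec k n →
    P.comp h i μ ν ∈ P.truncRec k r := by
  intro r
  induction r with
  | zero =>
    intro m n h i μ ν hν
    by_cases hk : n < k
    · rw [truncRec_lt P hk, Submodule.mem_bot] at hν
      simp [hν]
    · by_cases h0 : k = 0
      · subst h0; simp [truncRec_zero]
      · have := i.2
        omega
  | succ r ih =>
    intro m n h i μ ν hν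
    by_cases hk : n < k
    · rw [truncRec_lt P hk, Submodule.mem_bot] at hν
      simp [hν]
    · by_cases h0 : k = 0
      · subst h0; simp [truncRec_zero]
      · have hi := i.2
        rw [mem_truncRec P (n := r) rfl (by omega)]
        intro x
        rcases pos_cases h i x with ⟨a, ha, rfl⟩ | ⟨b, rfl⟩
        · have ha' := Fin.val_ne_of_ne ha
          rcases lt_or_gt_of_ne ha with hlt | hlt
          · have hlt' : a.1 < i.1 := hlt
            have := P.comp_comm (l := m) (m := 0) (n := n) (p := m - 1) (q := r + 1) (r := r)
              (by omega) (by omega) h rfl a i hlt μ P.unit0 ν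
            have e : outerPos h i a ha = ⟨a, by omega⟩ := by
              ext; simp [outerPos_val, shift, hlt']
            rw [e, ← this]
            exact ih _ _ _ _ hν
          · have hlt' : i.1 < a.1 := hlt
            have := P.comp_comm (l := m) (m := n) (n := 0) (p := r + 1) (q := m - 1) (r := r)
              h rfl (by omega) (by omega) i a hlt μ ν P.unit0
            have e : outerPos h i a ha = ⟨a + n - 1, by omega⟩ := by
              ext; simp [outerPos_val, shift, not_lt.mpr hlt'.le]
            rw [e, this]
            exact ih _ _ _ _ hν
        · have := P.comp_assoc (l := m) (m := n) (n := 0) (p := r + 1) (q := n - 1) (r := r)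
            h rfl (by omega) (by omega) i b μ ν P.unit0
          have e : innerPos h i b = ⟨i + b, by omega⟩ := rfl
          rw [e, this]
          exact ih _ _ _ _ ((mem_truncRec P _ (not_lt.mp hk) _).mp hν b)

theorem exists_smul_unit0 (P : UnitaryOperad 𝕜) (ν : P.obj 0) : ∃ c : 𝕜, ν = c • P.unit0 :=
  let ⟨c, hc⟩ := P.unit0_basis.2 ν
  ⟨c, hc.symm⟩

theorem truncRec_comp_left (P : UnitaryOperad 𝕜) (k : ℕ) : ∀ {r m n : ℕ} (h : m + n = r + 1)
    (i : Fin m) (μ : P.obj m) (ν : P.obj n), μ ∈ P.truncRec k m →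
    P.comp h i μ ν ∈ P.truncRec k r := by
  intro r
  induction r with
  | zero =>
    intro m n h i μ ν hμ
    by_cases hk : m < k
    · rw [truncRec_lt P hk, Submodule.mem_bot] at hμ
      simp [hμ]
    · obtain rfl : n = 0 := by have := i.2; omega
      obtain ⟨c, rfl⟩ := P.exists_smul_unit0 ν
      rw [map_smul]
      exact Submodule.smul_mem _ _ ((mem_truncRec P h (not_lt.mp hk) _).mp hμ i)
  | succ r ih =>
    intro m n h i μ ν hμ
    by_cases hk : m < k
    · rw [truncRec_lt P hk, Submodule.mem_bot] at hμ
      simp [hμ]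
    · rcases Nat.eq_zero_or_pos n with rfl | hn
      · obtain ⟨c, rfl⟩ := P.exists_smul_unit0 ν
        rw [map_smul]
        exact Submodule.smul_mem _ _ ((mem_truncRec P h (not_lt.mp hk) _).mp hμ i)
      · have hi := i.2
        rw [mem_truncRec P (n := r) rfl (by omega)]
        intro x
        rcases pos_cases h i x with ⟨a, ha, rfl⟩ | ⟨b, rfl⟩
        · have ha' := Fin.val_ne_of_ne ha
          rcases lt_or_gt_of_ne ha with hlt | hlt
          · have hlt' : a.1 < i.1 := hlt
            have := P.comp_comm (l := m) (m := 0) (n := n) (p := m - 1) (q := r + 1) (r := r)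
              (by omega) (by omega) h rfl a i hlt μ P.unit0 ν
            have e : outerPos h i a ha = ⟨a, by omega⟩ := by
              ext; simp [outerPos_val, shift, hlt']
            rw [e, ← this]
            exact ih _ _ _ _ ((mem_truncRec P _ (not_lt.mp hk) _).mp hμ _)
          · have hlt' : i.1 < a.1 := hlt
            have := P.comp_comm (l := m) (m := n) (n := 0) (p := r + 1) (q := m - 1) (r := r)
              h rfl (by omega) (by omega) i a hlt μ ν P.unit0
            have e : outerPos h i a ha = ⟨a + n - 1, by omega⟩ := by
              ext; simp [outerPos_val, shift, not_lt.mpr hlt'.le]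
            rw [e, this]
            exact ih _ _ _ _ ((mem_truncRec P _ (not_lt.mp hk) _).mp hμ _)
        · have := P.comp_assoc (l := m) (m := n) (n := 0) (p := r + 1) (q := n - 1) (r := r)
            h rfl (by omega) (by omega) i b μ ν P.unit0
          have e : innerPos h i b = ⟨i + b, by omega⟩ := rfl
          rw [e, this]
          exact ih _ _ _ _ hμ

/-- Composition with `1_χ` in the first `n` slots, for `χ` given as a `Bool`-valued function. -/
def fill (P : UnitaryOperad 𝕜) (n s : ℕ) {r : ℕ} (c : Fin n → Bool)
    (h : (∑ i, (c i).toNat) + s = r) : P.obj (n + s) →ₗ[𝕜] P.obj r :=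
  P.totalComp n s (fun i => (c i).toNat) (fun i => P.unitOf (c i)) h

theorem fill_succ (P : UnitaryOperad 𝕜) (n s t : ℕ) {r : ℕ} (c : Fin (n + 1) → Bool)
    (h : (∑ i, (c i).toNat) + s = r) (θ : P.obj (n + 1 + s)) (b : Bool)
    (hb : c (Fin.last n) = b) (ht : b.toNat + s = t) :
    P.fill (n + 1) s c h θ = P.fill n t (fun i => c i.castSucc)
      (by rw [Fin.sum_univ_castSucc, hb] at h; omega)
      (P.comp (r := n + t) (by omega) ⟨n, by omega⟩ θ (P.unitOf b)) := by
  subst hb ht; rfl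

theorem fill_mem (P : UnitaryOperad 𝕜) (k n s : ℕ) {r : ℕ} (c : Fin n → Bool)
    (h : (∑ i, (c i).toNat) + s = r) (θ : P.obj (n + s)) (hθ : θ ∈ P.truncRec k (n + s)) :
    P.fill n s c h θ ∈ P.truncRec k r := by
  induction n generalizing s with
  | zero => exact P.truncRec_comp_right k _ _ _ _ hθ
  | succ n ih =>
    rw [fill_succ P n s _ c h θ _ rfl rfl]
    exact ih _ _ _ _ (P.truncRec_comp_left k _ _ _ _ hθ)

theorem fill_insert (P : UnitaryOperad 𝕜) (n s : ℕ) {r : ℕ} (c' : Fin (n + 1) → Bool)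
    (c : Fin n → Bool) (i : Fin (n + 1)) (hi : c' i = false)
    (hc : ∀ j, c' (i.succAbove j) = c j) (h' : (∑ i, (c' i).toNat) + s = r)
    (h : (∑ i, (c i).toNat) + s = r) (θ : P.obj (n + 1 + s)) :
    P.fill (n + 1) s c' h' θ =
      P.fill n s c h (P.comp (r := n + s) (by omega) ⟨i, by omega⟩ θ P.unit0) := by
  rcases Fin.eq_castSucc_or_eq_last i with ⟨i, rfl⟩ | rfl
  · induction n generalizing s with
    | zero => exact i.elim0
    | succ n ih =>
      have hl : c' (Fin.last (n + 1)) = c (Fin.last n) := by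
        rw [← hc]; congr 1; simp
      rw [fill_succ P (n + 1) s _ c' h' θ _ hl rfl, fill_succ P n s _ c h _ _ rfl rfl]
      have hc2 : ∀ j : Fin n, c' (i.succAbove j).castSucc = c j.castSucc := fun j => by
        rw [← hc]; congr 1; simp
      have step : ∀ (t : ℕ) (g) (g') (x : P.obj (n + 1 + t)),
          P.fill (r := r) (n + 1) t (fun i => c' i.castSucc) g x = P.fill (r := r) n t (fun i => c i.castSucc) g'
            (P.comp (r := n + t) (by omega) ⟨i, by omega⟩ x P.unit0) := by
        intro t g g' x
        rcases Fin.eq_castSucc_or_eq_last i with ⟨i, rfl⟩ | rfl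
        · exact ih t (fun i => c' i.castSucc) (fun i => c i.castSucc) g g' x i hi hc2
        · rw [fill_succ P n t t _ g x _ hi (by simp)]
          have e : (fun j : Fin n => c' j.castSucc.castSucc) = fun j => c j.castSucc := by
            funext j; rw [← hc2]; congr 2; simp
          simp only [e]
          rfl
      rw [step _ _ (by rw [Fin.sum_univ_castSucc] at h; omega)]
      congr 1
      exact P.comp_comm (l := n + 1 + 1 + s) (m := 0) _ _ _ _ ⟨i, by omega⟩
        ⟨n + 1, by omega⟩ (by rw [Fin.lt_def]; exact i.2) θ P.unit0 _ |>.symm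
  · rw [fill_succ P _ s s c' h' θ _ hi (by simp)]
    obtain rfl : (fun j => c' j.castSucc) = c := by
      funext j; rw [← hc]; congr 1; simp
    rfl

theorem fill_injective (P : UnitaryOperad 𝕜) (n s : ℕ) {r : ℕ} (c : Fin n → Bool)
    (h : (∑ i, (c i).toNat) + s = r) (hc : ∀ i, c i = true) (θ : P.obj (n + s))
    (hθ : P.fill n s c h θ = 0) : θ = 0 := by
  have key : ∀ {a b : ℕ} (e : a + 1 = b + 1) (i : Fin a) (x : P.obj a),
      P.comp e i x P.one = 0 → x = 0 := by
    intro a b e i x hx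
    obtain rfl : a = b := by omega
    rwa [P.comp_one] at hx
  induction n generalizing s with
  | zero =>
    obtain rfl : r = 0 + s := by simp at h; omega
    have := P.one_comp (by omega) θ
    rw [← this]; exact hθ
  | succ n ih =>
    rw [fill_succ P n s _ c h θ _ (hc _) rfl] at hθ
    exact key _ _ _ (ih _ _ _ (fun i => hc _) _ hθ)

theorem truncSubmodule_eq (P : UnitaryOperad 𝕜) (k n : ℕ) :
    P.truncSubmodule k n = P.truncRec k n := by
  by_cases hn : n < k
  · rw [truncRec_lt P hn, truncSubmodule, if_pos hn]
  rcases Nat.eq_zero_or_pos k with rfl | hk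
  · simp [truncSubmodule, truncRec_zero]
  ext θ
  have hmem : θ ∈ P.truncSubmodule k n ↔
      ∀ (r : ℕ) (c : Fin n → Bool) (h : (∑ i, (c i).toNat) + 0 = r), r + 1 = k →
        P.fill n 0 c h θ = 0 := by
    simp only [truncSubmodule, if_neg hn, Submodule.mem_iInf, LinearMap.mem_ker]
    constructor
    · intro H r c h hr
      have hc : c = fun i => decide (i ∈ Finset.univ.filter fun i => c i = true) := by
        funext i; simp
      generalize (Finset.univ.filter fun i => c i = true) = I at hc
      subst hc
      obtain rfl : I.card = r := (sum_toNat I).symm.trans h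
      exact H I hr
    · intro H I hI
      exact H _ _ _ hI
  rw [hmem]
  constructor
  · have main : ∀ (n : ℕ) (θ : P.obj n), k ≤ n + 1 → (∀ (r : ℕ) (c : Fin n → Bool)
        (h : (∑ i, (c i).toNat) + 0 = r), r + 1 = k → P.fill n 0 c h θ = 0) →
        θ ∈ P.truncRec k n := by
      intro n
      induction n with
      | zero =>
        intro θ hk' H
        have := fill_injective P 0 0 (fun _ => true) rfl (fun _ => rfl) θ
          (H _ _ _ (by simp; omega))
        rw [this]; exact zero_mem _
      | succ n ih =>
        intro θ hk' H
        by_cases hkn : k = n + 2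
        · have := fill_injective P (n + 1) 0 (fun _ => true) rfl (fun _ => rfl) θ
            (H _ _ _ (by simp; omega))
          rw [this]; exact zero_mem _
        · rw [mem_truncRec P (n := n) rfl (by omega)]
          intro i
          refine ih _ (by omega) fun r c h hr => ?_
          have hs : (∑ j, (i.insertNth (α := fun _ => Bool) false c j).toNat) + 0 = r := by
            rw [Fin.sum_univ_succAbove _ i]; simpa using h
          have := fill_insert P n 0 (i.insertNth (α := fun _ => Bool) false c) c i
            (by simp) (by simp) hs h θ
          exact this.symm.trans (H _ _ _ hr)
    exact main n θ (by omega)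
  · intro hθ r c h hr
    have := fill_mem P k n 0 c h θ hθ
    rwa [truncRec_lt P (by omega), Submodule.mem_bot] at this

/-- The `k`-th truncation ideal of a unitary operad. -/
def truncIdeal (P : UnitaryOperad 𝕜) (k : ℕ) : P.OpIdeal where
  carrier := P.truncSubmodule k
  act_mem σ θ hθ := by
    rw [truncSubmodule_eq] at *
    exact truncRec_act P k σ θ hθ
  comp_mem_left h i μ ν hμ := by
    rw [truncSubmodule_eq] at *
    exact truncRec_comp_left P k h i μ ν hμ
  comp_mem_right h i μ ν hν := by
    rw [truncSubmodule_eq] at *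
    exact truncRec_comp_right P k h i μ ν hν

/-- The quotient of a unitary operad by its `k`-th truncation ideal. -/
abbrev modTrunc (P : UnitaryOperad 𝕜) (k : ℕ) : Operad 𝕜 := P.quotient (P.truncIdeal k)

end UnitaryOperad

/-! ### The operads of unital associative and of unital commutative algebras -/

section AsCom

variable (𝕜 : Type u) [CommRing 𝕜]

/-- The operad `As` of unital associative algebras: `As(n)` is the free module on the symmetric
group, with the action by right multiplication. -/
noncomputable def As : UnitaryOperad 𝕜 where
  obj n := Equiv.Perm (Fin n) →₀ 𝕜
  act σ := Finsupp.lmapDomain 𝕜 𝕜 (· * σ)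
  one := Finsupp.single 1 1
  comp h i := Finsupp.linearCombination 𝕜 fun φ => Finsupp.lmapDomain 𝕜 𝕜 (permComp h i φ)
  act_one θ := by
    induction θ using Finsupp.induction_linear with
    | zero => simp
    | add x y hx hy => rw [map_add, hx, hy]
    | single φ c => simp
  act_mul σ τ θ := by
    induction θ using Finsupp.induction_linear with
    | zero => simp
    | add x y hx hy => simp only [map_add, hx, hy]
    | single φ c => simp [mul_assoc]
  comp_one i θ := by
    induction θ using Finsupp.induction_linear with
    | zero => simp
    | add x y hx hy => simp only [map_add, LinearMap.add_apply, hx, hy]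
    | single φ c => simp [permComp_one_right]
  one_comp h θ := by
    induction θ using Finsupp.induction_linear with
    | zero => simp
    | add x y hx hy => simp only [map_add, hx, hy]
    | single φ c => simp [permComp_one_left]
  comp_assoc hp hr hq hr' i j a b c := by
    induction a using Finsupp.induction_linear with
    | zero => simp
    | add x y hx hy => simp only [map_add, LinearMap.add_apply, hx, hy]
    | single φ s =>
      induction b using Finsupp.induction_linear with
      | zero => simp
      | add x y hx hy => simp only [map_add, LinearMap.add_apply, hx, hy]
      | single σ t =>
        induction c using Finsupp.induction_linear with
        | zero => simp
        | add x y hx hy => simp only [map_add, hx, hy]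
        | single τ w => simp [permComp_assoc hp hr hq hr', mul_assoc, -Finsupp.single_mul]
  comp_comm hp hr hq hr' i j hij a b c := by
    induction a using Finsupp.induction_linear with
    | zero => simp
    | add x y hx hy => simp only [map_add, LinearMap.add_apply, hx, hy]
    | single φ s =>
      induction b using Finsupp.induction_linear with
      | zero => simp
      | add x y hx hy => simp only [map_add, LinearMap.add_apply, hx, hy]
      | single σ t =>
        induction c using Finsupp.induction_linear with
        | zero => simp
        | add x y hx hy => simp only [map_add, LinearMap.add_apply, hx, hy]
        | single τ w =>
          simp [permComp_comm hp hr hq hr' i j hij, mul_comm, mul_left_comm,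
            -Finsupp.single_mul]
  comp_act h i μ ν σ := by
    induction μ using Finsupp.induction_linear with
    | zero => simp
    | add x y hx hy => simp only [map_add, LinearMap.add_apply, hx, hy]
    | single φ s =>
      induction ν using Finsupp.induction_linear with
      | zero => simp
      | add x y hx hy => simp only [map_add, hx, hy]
      | single τ w => 
        have e := permComp_mul h i φ 1 τ σ
        rw [mul_one, Equiv.Perm.one_apply] at e
        simp [e, -Finsupp.single_mul]
  act_comp h i μ ν φ := by
    induction μ using Finsupp.induction_linear with
    | zero => simp
    | add x y hx hy => simp only [map_add, LinearMap.add_apply, hx, hy]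
    | single ψ s =>
      induction ν using Finsupp.induction_linear with
      | zero => simp
      | add x y hx hy => simp only [map_add, hx, hy]
      | single τ w => simp [← permComp_mul, -Finsupp.single_mul]
  unit0 := Finsupp.single 1 1
  unit0_basis := by
    constructor
    · intro a b hab
      simpa using DFunLike.congr_fun hab 1
    · intro θ
      refine ⟨θ 1, ?_⟩
      refine Finsupp.ext fun σ => ?_
      obtain rfl := Subsingleton.elim σ 1
      simp

/-- The operad `Com` of unital commutative algebras: `Com(n) = 𝕜` with trivial action, all partial
compositions being the multiplication of `𝕜`. -/
def Com : UnitaryOperad 𝕜 where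
  obj _ := 𝕜
  act _ := LinearMap.id
  one := (1 : 𝕜)
  comp _ _ := LinearMap.mul 𝕜 𝕜
  act_one _ := rfl
  act_mul _ _ _ := rfl
  comp_one _ θ := mul_one θ
  one_comp _ θ := one_mul θ
  comp_assoc _ _ _ _ _ _ a b c := mul_assoc a b c
  comp_comm _ _ _ _ _ _ _ a b c := mul_right_comm a b c
  comp_act _ _ _ _ _ := rfl
  act_comp _ _ _ _ _ := rfl
  unit0 := (1 : 𝕜)
  unit0_basis := ⟨fun a b h => by simpa using h, fun a => ⟨a, by simp⟩⟩

end AsCom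

/-! ### Operads presented by generators and relations -/

/-- Formal expressions in a collection `G` of generators: the terms of the language of operads
over `𝕜`. -/
inductive OpTerm (𝕜 : Type u) (G : ℕ → Type) : ℕ → Type u
  | gen {n : ℕ} (g : G n) : OpTerm 𝕜 G n
  | one : OpTerm 𝕜 G 1
  | zero (n : ℕ) : OpTerm 𝕜 G n
  | add {n : ℕ} (a b : OpTerm 𝕜 G n) : OpTerm 𝕜 G n
  | smul {n : ℕ} (c : 𝕜) (a : OpTerm 𝕜 G n) : OpTerm 𝕜 G n
  | act {n : ℕ} (σ : Equiv.Perm (Fin n)) (a : OpTerm 𝕜 G n) : OpTerm 𝕜 G n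
  | comp {m n r : ℕ} (h : m + n = r + 1) (i : Fin m) (a : OpTerm 𝕜 G m) (b : OpTerm 𝕜 G n) :
      OpTerm 𝕜 G r

/-- The congruence on formal expressions generated by the relations `R` and by the axioms of an
operad. -/
inductive OpRel {𝕜 : Type u} [CommRing 𝕜] {G : ℕ → Type}
    (R : ∀ n, OpTerm 𝕜 G n → OpTerm 𝕜 G n → Prop) :
    ∀ {n : ℕ}, OpTerm 𝕜 G n → OpTerm 𝕜 G n → Prop
  | of {n} {a b : OpTerm 𝕜 G n} : R n a b → OpRel R a b
  | refl {n} (a : OpTerm 𝕜 G n) : OpRel R a a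
  | symm {n} {a b : OpTerm 𝕜 G n} : OpRel R a b → OpRel R b a
  | trans {n} {a b c : OpTerm 𝕜 G n} : OpRel R a b → OpRel R b c → OpRel R a c
  | add_congr {n} {a a' b b' : OpTerm 𝕜 G n} : OpRel R a a' → OpRel R b b' →
      OpRel R (.add a b) (.add a' b')
  | smul_congr {n} (c : 𝕜) {a a' : OpTerm 𝕜 G n} : OpRel R a a' →
      OpRel R (.smul c a) (.smul c a')
  | act_congr {n} (σ : Equiv.Perm (Fin n)) {a a' : OpTerm 𝕜 G n} : OpRel R a a' →
      OpRel R (.act σ a) (.act σ a')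
  | comp_congr {m n r} (h : m + n = r + 1) (i : Fin m) {a a' : OpTerm 𝕜 G m}
      {b b' : OpTerm 𝕜 G n} : OpRel R a a' → OpRel R b b' →
      OpRel R (.comp h i a b) (.comp h i a' b')
  | add_assoc {n} (a b c : OpTerm 𝕜 G n) :
      OpRel R (.add (.add a b) c) (.add a (.add b c))
  | add_comm {n} (a b : OpTerm 𝕜 G n) : OpRel R (.add a b) (.add b a)
  | zero_add {n} (a : OpTerm 𝕜 G n) : OpRel R (.add (.zero n) a) a
  | neg_add {n} (a : OpTerm 𝕜 G n) : OpRel R (.add (.smul (-1) a) a) (.zero n)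
  | one_smul {n} (a : OpTerm 𝕜 G n) : OpRel R (.smul 1 a) a
  | mul_smul {n} (c d : 𝕜) (a : OpTerm 𝕜 G n) :
      OpRel R (.smul (c * d) a) (.smul c (.smul d a))
  | add_smul {n} (c d : 𝕜) (a : OpTerm 𝕜 G n) :
      OpRel R (.smul (c + d) a) (.add (.smul c a) (.smul d a))
  | smul_add {n} (c : 𝕜) (a b : OpTerm 𝕜 G n) :
      OpRel R (.smul c (.add a b)) (.add (.smul c a) (.smul c b))
  | act_add {n} (σ : Equiv.Perm (Fin n)) (a b : OpTerm 𝕜 G n) :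
      OpRel R (.act σ (.add a b)) (.add (.act σ a) (.act σ b))
  | act_smul {n} (σ : Equiv.Perm (Fin n)) (c : 𝕜) (a : OpTerm 𝕜 G n) :
      OpRel R (.act σ (.smul c a)) (.smul c (.act σ a))
  | comp_add {m n r} (h : m + n = r + 1) (i : Fin m) (a : OpTerm 𝕜 G m) (b b' : OpTerm 𝕜 G n) :
      OpRel R (.comp h i a (.add b b')) (.add (.comp h i a b) (.comp h i a b'))
  | comp_smul {m n r} (h : m + n = r + 1) (i : Fin m) (c : 𝕜) (a : OpTerm 𝕜 G m)
      (b : OpTerm 𝕜 G n) : OpRel R (.comp h i a (.smul c b)) (.smul c (.comp h i a b))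
  | add_comp {m n r} (h : m + n = r + 1) (i : Fin m) (a a' : OpTerm 𝕜 G m) (b : OpTerm 𝕜 G n) :
      OpRel R (.comp h i (.add a a') b) (.add (.comp h i a b) (.comp h i a' b))
  | smul_comp {m n r} (h : m + n = r + 1) (i : Fin m) (c : 𝕜) (a : OpTerm 𝕜 G m)
      (b : OpTerm 𝕜 G n) : OpRel R (.comp h i (.smul c a) b) (.smul c (.comp h i a b))
  | act_one {n} (a : OpTerm 𝕜 G n) : OpRel R (.act 1 a) a
  | act_mul {n} (σ τ : Equiv.Perm (Fin n)) (a : OpTerm 𝕜 G n) :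
      OpRel R (.act (σ * τ) a) (.act τ (.act σ a))
  | comp_one {n} (i : Fin n) (a : OpTerm 𝕜 G n) : OpRel R (.comp rfl i a .one) a
  | one_comp {n} (h : 1 + n = n + 1) (a : OpTerm 𝕜 G n) : OpRel R (.comp h 0 .one a) a
  | comp_assoc {l m n p q r} (hp : l + m = p + 1) (hr : p + n = r + 1)
      (hq : m + n = q + 1) (hr' : l + q = r + 1) (i : Fin l) (j : Fin m)
      (a : OpTerm 𝕜 G l) (b : OpTerm 𝕜 G m) (c : OpTerm 𝕜 G n) :
      OpRel R (.comp hr ⟨i + j, by omega⟩ (.comp hp i a b) c) (.comp hr' i a (.comp hq j b c))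
  | comp_comm {l m n p q r} (hp : l + m = p + 1) (hr : p + n = r + 1)
      (hq : l + n = q + 1) (hr' : q + m = r + 1) (i j : Fin l) (_ : i < j)
      (a : OpTerm 𝕜 G l) (b : OpTerm 𝕜 G m) (c : OpTerm 𝕜 G n) :
      OpRel R (.comp hr ⟨j + m - 1, by omega⟩ (.comp hp i a b) c)
        (.comp hr' ⟨i, by omega⟩ (.comp hq j a c) b)
  | comp_act {m n r} (h : m + n = r + 1) (i : Fin m) (a : OpTerm 𝕜 G m) (b : OpTerm 𝕜 G n)
      (σ : Equiv.Perm (Fin n)) :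
      OpRel R (.comp h i a (.act σ b)) (.act (permComp h i 1 σ) (.comp h i a b))
  | act_comp {m n r} (h : m + n = r + 1) (i : Fin m) (a : OpTerm 𝕜 G m) (b : OpTerm 𝕜 G n)
      (φ : Equiv.Perm (Fin m)) :
      OpRel R (.comp h i (.act φ a) b) (.act (permComp h i φ 1) (.comp h (φ i) a b))

section Presented

variable {𝕜 : Type u} [CommRing 𝕜] {G : ℕ → Type}
  (R : ∀ n, OpTerm 𝕜 G n → OpTerm 𝕜 G n → Prop)

def opSetoid (n : ℕ) : Setoid (OpTerm 𝕜 G n) :=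
  ⟨OpRel R, .refl, .symm, .trans⟩

/-- Operations of arity `n` of the operad with generators `G` and relations `R`. -/
def PresentedObj (n : ℕ) : Type u := Quotient (opSetoid R n)

namespace PresentedObj

variable {R}

instance (n : ℕ) : Add (PresentedObj R n) :=
  ⟨Quotient.map₂ OpTerm.add fun _ _ h _ _ h' => OpRel.add_congr h h'⟩

instance (n : ℕ) : Zero (PresentedObj R n) := ⟨Quotient.mk _ (.zero n)⟩

instance (n : ℕ) : Neg (PresentedObj R n) :=
  ⟨Quotient.map (OpTerm.smul (-1)) fun _ _ h => OpRel.smul_congr _ h⟩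

instance (n : ℕ) : AddCommGroup (PresentedObj R n) where
  nsmul := nsmulRec
  zsmul := zsmulRec
  add_assoc := by
    rintro ⟨a⟩ ⟨b⟩ ⟨c⟩; exact Quotient.sound (.add_assoc a b c)
  add_comm := by
    rintro ⟨a⟩ ⟨b⟩; exact Quotient.sound (.add_comm a b)
  zero_add := by
    rintro ⟨a⟩; exact Quotient.sound (.zero_add a)
  add_zero := by
    rintro ⟨a⟩; exact Quotient.sound (.trans (.add_comm a _) (.zero_add a))
  neg_add_cancel := by
    rintro ⟨a⟩; exact Quotient.sound (.neg_add a)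

instance (n : ℕ) : Module 𝕜 (PresentedObj R n) where
  smul c := Quotient.map (OpTerm.smul c) fun _ _ h => OpRel.smul_congr c h
  one_smul := by
    rintro ⟨a⟩; exact Quotient.sound (.one_smul a)
  mul_smul := by
    rintro c d ⟨a⟩; exact Quotient.sound (.mul_smul c d a)
  smul_zero c := by
    let z : PresentedObj R n := Quotient.mk _ (OpTerm.smul c (.zero n))
    have h : z = z + z := Quotient.sound (s := opSetoid R n)
      (OpRel.trans (OpRel.smul_congr c (OpRel.symm (OpRel.zero_add _))) (OpRel.smul_add c _ _))
    exact left_eq_add.mp h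
  smul_add := by
    rintro c ⟨a⟩ ⟨b⟩; exact Quotient.sound (.smul_add c a b)
  add_smul := by
    rintro c d ⟨a⟩; exact Quotient.sound (.add_smul c d a)
  zero_smul := by
    rintro ⟨a⟩
    let z : PresentedObj R n := Quotient.mk _ (OpTerm.smul (0 : 𝕜) a)
    have e : OpRel R (.smul ((0 : 𝕜) + 0) a) (.add (.smul 0 a) (.smul 0 a)) :=
      OpRel.add_smul 0 0 a
    rw [_root_.zero_add] at e
    have h : z = z + z := Quotient.sound (s := opSetoid R n) e
    exact left_eq_add.mp h

end PresentedObj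

/-- The operad with generators `G` and relations `R`. -/
def presented : Operad 𝕜 where
  obj := PresentedObj R
  act σ :=
    { toFun := Quotient.map (OpTerm.act σ) fun _ _ h => OpRel.act_congr σ h
      map_add' := by rintro ⟨a⟩ ⟨b⟩; exact Quotient.sound (.act_add σ a b)
      map_smul' := by rintro c ⟨a⟩; exact Quotient.sound (.act_smul σ c a) }
  one := Quotient.mk _ .one
  comp h i := LinearMap.mk₂ 𝕜
    (Quotient.map₂ (OpTerm.comp h i) fun _ _ e _ _ e' => OpRel.comp_congr h i e e')
    (by rintro ⟨a⟩ ⟨a'⟩ ⟨b⟩; exact Quotient.sound (.add_comp h i a a' b))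
    (by rintro c ⟨a⟩ ⟨b⟩; exact Quotient.sound (.smul_comp h i c a b))
    (by rintro ⟨a⟩ ⟨b⟩ ⟨b'⟩; exact Quotient.sound (.comp_add h i a b b'))
    (by rintro c ⟨a⟩ ⟨b⟩; exact Quotient.sound (.comp_smul h i c a b))
  act_one := by rintro n ⟨a⟩; exact Quotient.sound (.act_one a)
  act_mul := by rintro n σ τ ⟨a⟩; exact Quotient.sound (.act_mul σ τ a)
  comp_one := by rintro n i ⟨a⟩; exact Quotient.sound (.comp_one i a)
  one_comp := by rintro n h ⟨a⟩; exact Quotient.sound (.one_comp h a)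
  comp_assoc := by
    rintro l m n p q r hp hr hq hr' i j ⟨a⟩ ⟨b⟩ ⟨c⟩
    exact Quotient.sound (.comp_assoc hp hr hq hr' i j a b c)
  comp_comm := by
    rintro l m n p q r hp hr hq hr' i j hij ⟨a⟩ ⟨b⟩ ⟨c⟩
    exact Quotient.sound (.comp_comm hp hr hq hr' i j hij a b c)
  comp_act := by
    rintro m n r h i ⟨a⟩ ⟨b⟩ σ; exact Quotient.sound (.comp_act h i a b σ)
  act_comp := by
    rintro m n r h i ⟨a⟩ ⟨b⟩ φ; exact Quotient.sound (.act_comp h i a b φ)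

/-- The class of an expression in the presented operad. -/
def presentedMk {n : ℕ} (t : OpTerm 𝕜 G n) : (presented R).obj n := Quotient.mk _ t

variable {R}

/-- Evaluation of expressions in an operad. -/
def OpTerm.eval (Q : Operad 𝕜) (g : ∀ n, G n → Q.obj n) : ∀ {n : ℕ}, OpTerm 𝕜 G n → Q.obj n
  | _, .gen x => g _ x
  | _, .one => Q.one
  | _, .zero _ => 0
  | _, .add a b => a.eval Q g + b.eval Q g
  | _, .smul c a => c • a.eval Q g
  | _, .act σ a => Q.act σ (a.eval Q g)
  | _, .comp h i a b => Q.comp h i (a.eval Q g) (b.eval Q g)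

theorem OpRel.eval_eq (Q : Operad 𝕜) (g : ∀ n, G n → Q.obj n)
    (hR : ∀ n a b, R n a b → a.eval Q g = b.eval Q g) {n : ℕ} {a b : OpTerm 𝕜 G n}
    (h : OpRel R a b) : a.eval Q g = b.eval Q g := by
  induction h with
  | of h => exact hR _ _ _ h
  | refl => rfl
  | symm _ ih => exact ih.symm
  | trans _ _ ih ih' => exact ih.trans ih'
  | add_congr _ _ ih ih' => simp only [OpTerm.eval, ih, ih']
  | smul_congr _ _ ih => simp only [OpTerm.eval, ih]
  | act_congr _ _ ih => simp only [OpTerm.eval, ih]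
  | comp_congr _ _ _ _ ih ih' => simp only [OpTerm.eval, ih, ih']
  | add_assoc => exact _root_.add_assoc _ _ _
  | add_comm => exact _root_.add_comm _ _
  | zero_add => exact _root_.zero_add _
  | neg_add => simp [OpTerm.eval]
  | one_smul => exact _root_.one_smul _ _
  | mul_smul => exact SemigroupAction.mul_smul _ _ _
  | add_smul => exact _root_.add_smul _ _ _
  | smul_add => exact _root_.smul_add _ _ _
  | act_add => simp [OpTerm.eval]
  | act_smul => simp [OpTerm.eval]
  | comp_add => simp [OpTerm.eval]
  | comp_smul => simp [OpTerm.eval]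
  | add_comp => simp [OpTerm.eval]
  | smul_comp => simp [OpTerm.eval]
  | act_one => exact Q.act_one _
  | act_mul => exact Q.act_mul _ _ _
  | comp_one => exact Q.comp_one _ _
  | one_comp => exact Q.one_comp _ _
  | comp_assoc hp hr hq hr' i j => exact Q.comp_assoc hp hr hq hr' i j _ _ _
  | comp_comm hp hr hq hr' i j hij => exact Q.comp_comm hp hr hq hr' i j hij _ _ _
  | comp_act => exact Q.comp_act _ _ _ _ _
  | act_comp => exact Q.act_comp _ _ _ _ _

/-- The universal property of the presented operad: elements of an operad `Q` that satisfy the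
relations define a morphism to `Q`. -/
def presentedLift (Q : Operad 𝕜) (g : ∀ n, G n → Q.obj n)
    (hR : ∀ n a b, R n a b → a.eval Q g = b.eval Q g) : OperadHom (presented R) Q where
  toFun n :=
    { toFun := Quotient.lift (fun t => OpTerm.eval Q g t) fun _ _ h => OpRel.eval_eq Q g hR h
      map_add' := by rintro ⟨a⟩ ⟨b⟩; rfl
      map_smul' := by rintro c ⟨a⟩; rfl }
  map_one := rfl
  map_act := by rintro n σ ⟨a⟩; rfl
  map_comp := by rintro m n r h i ⟨a⟩ ⟨b⟩; rfl

end Presented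

/-! ### The operad of unital commutative Poisson algebras -/

/-- The generators of `Pois`: the unit, the product and the bracket. -/
inductive PoisGen : ℕ → Type
  | unit : PoisGen 0
  | mul : PoisGen 2
  | br : PoisGen 2

section Pois

variable (𝕜 : Type u) [CommRing 𝕜]

/-- The unit, the product and the bracket as expressions. -/
abbrev unitT : OpTerm 𝕜 PoisGen 0 := .gen .unit
abbrev mulT : OpTerm 𝕜 PoisGen 2 := .gen .mul
abbrev brT : OpTerm 𝕜 PoisGen 2 := .gen .br

/-- The defining relations of `Pois`. The variables of an operation are numbered from `0`, and the
transposition is the one of the first two variables. -/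
inductive PoisRel : ∀ n : ℕ, OpTerm 𝕜 PoisGen n → OpTerm 𝕜 PoisGen n → Prop
  /-- `1 · x = x` and `x · 1 = x` -/
  | mul_unit (i : Fin 2) : PoisRel 1 (.comp (m := 2) (n := 0) rfl i (mulT 𝕜) (unitT 𝕜)) .one
  /-- `[1, x] = 0` and `[x, 1] = 0` -/
  | br_unit (i : Fin 2) : PoisRel 1 (.comp (m := 2) (n := 0) rfl i (brT 𝕜) (unitT 𝕜)) (.zero 1)
  /-- `y · x = x · y` -/
  | mul_comm : PoisRel 2 (.act (Equiv.swap 0 1) (mulT 𝕜)) (mulT 𝕜)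
  /-- `[y, x] = -[x, y]` -/
  | br_skew : PoisRel 2 (.act (Equiv.swap 0 1) (brT 𝕜)) (.smul (-1) (brT 𝕜))
  /-- `(x · y) · z = x · (y · z)` -/
  | mul_assoc : PoisRel 3 (.comp (m := 2) (n := 2) rfl 0 (mulT 𝕜) (mulT 𝕜)) (.comp (m := 2) (n := 2) rfl 1 (mulT 𝕜) (mulT 𝕜))
  /-- `[x · y, z] = x · [y, z] + y · [x, z]` -/
  | leibniz : PoisRel 3 (.comp (m := 2) (n := 2) rfl 0 (brT 𝕜) (mulT 𝕜))
      (.add (.comp (m := 2) (n := 2) rfl 1 (mulT 𝕜) (brT 𝕜))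
        (.act (Equiv.swap 0 1) (.comp (m := 2) (n := 2) rfl 1 (mulT 𝕜) (brT 𝕜))))
  /-- `[x, [y, z]] = [[x, y], z] + [y, [x, z]]` -/
  | jacobi : PoisRel 3 (.comp (m := 2) (n := 2) rfl 1 (brT 𝕜) (brT 𝕜))
      (.add (.comp (m := 2) (n := 2) rfl 0 (brT 𝕜) (brT 𝕜))
        (.act (Equiv.swap 0 1) (.comp (m := 2) (n := 2) rfl 1 (brT 𝕜) (brT 𝕜))))

/-- The operad `Pois` of unital commutative Poisson algebras, without its unitary structure. -/
abbrev PoisOperad : Operad 𝕜 := presented (PoisRel 𝕜)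

variable {𝕜}

/-- The operations all of whose full substitutions of `e` are multiples of `e`. -/
def scalarRec (P : Operad 𝕜) (e : P.obj 0) : ∀ n, Submodule 𝕜 (P.obj n)
  | 0 => Submodule.span 𝕜 {e}
  | n + 1 => ⨅ i : Fin (n + 1), (scalarRec P e n).comap
      ((P.comp (m := n + 1) (n := 0) (r := n) rfl i).flip e)

theorem mem_scalarRec (P : Operad 𝕜) (e : P.obj 0) {n m : ℕ} (h : m + 0 = n + 1) (θ : P.obj m) :
    θ ∈ scalarRec P e m ↔ ∀ i, P.comp h i θ e ∈ scalarRec P e n := by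
  obtain rfl : m = n + 1 := h
  simp [scalarRec]

theorem scalarRec_act (P : Operad 𝕜) (e : P.obj 0) {n : ℕ} (σ : Equiv.Perm (Fin n))
    (θ : P.obj n) (hθ : θ ∈ scalarRec P e n) : P.act σ θ ∈ scalarRec P e n := by
  induction n with
  | zero => rwa [Subsingleton.elim σ 1, P.act_one]
  | succ n ih =>
    rw [mem_scalarRec P e rfl] at *
    intro i
    rw [P.act_comp]
    exact ih _ _ (hθ _)

theorem scalarRec_comp (P : Operad 𝕜) (e : P.obj 0) : ∀ {r m n : ℕ} (h : m + n = r + 1)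
    (i : Fin m) (μ : P.obj m) (ν : P.obj n), μ ∈ scalarRec P e m → ν ∈ scalarRec P e n →
    P.comp h i μ ν ∈ scalarRec P e r := by
  have base : ∀ {r m : ℕ} (h : m + 0 = r + 1) (i : Fin m) (μ : P.obj m) (ν : P.obj 0),
      μ ∈ scalarRec P e m → ν ∈ scalarRec P e 0 → P.comp h i μ ν ∈ scalarRec P e r := by
    intro r m h i μ ν hμ hν
    obtain ⟨c, rfl⟩ := Submodule.mem_span_singleton.mp hν
    rw [map_smul]
    exact Submodule.smul_mem _ _ ((mem_scalarRec P e h _).mp hμ i)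
  intro r
  induction r with
  | zero =>
    intro m n h i μ ν hμ hν
    obtain rfl : n = 0 := by have := i.2; omega
    exact base h i μ ν hμ hν
  | succ r ih =>
    intro m n h i μ ν hμ hν
    rcases Nat.eq_zero_or_pos n with rfl | hn
    · exact base h i μ ν hμ hν
    · rw [mem_scalarRec P e (n := r) rfl]
      intro x
      rcases pos_cases h i x with ⟨a, ha, rfl⟩ | ⟨b, rfl⟩
      · have ha' := Fin.val_ne_of_ne ha
        rcases lt_or_gt_of_ne ha with hlt | hlt
        · have hlt' : a.1 < i.1 := hlt
          have := P.comp_comm (l := m) (m := 0) (n := n) (p := m - 1) (q := r + 1) (r := r)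
            (by omega) (by omega) h rfl a i hlt μ e ν
          have e' : outerPos h i a ha = ⟨a, by omega⟩ := by
            ext; simp [outerPos_val, shift, hlt']
          rw [e', ← this]
          exact ih _ _ _ _ ((mem_scalarRec P e _ _).mp hμ _) hν
        · have hlt' : i.1 < a.1 := hlt
          have := P.comp_comm (l := m) (m := n) (n := 0) (p := r + 1) (q := m - 1) (r := r)
            h rfl (by omega) (by omega) i a hlt μ ν e
          have e' : outerPos h i a ha = ⟨a + n - 1, by omega⟩ := by
            ext; simp [outerPos_val, shift, not_lt.mpr hlt'.le]
          rw [e', this]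
          exact ih _ _ _ _ ((mem_scalarRec P e _ _).mp hμ _) hν
      · have := P.comp_assoc (l := m) (m := n) (n := 0) (p := r + 1) (q := n - 1) (r := r)
          h rfl (by omega) (by omega) i b μ ν e
        have e' : innerPos h i b = ⟨i + b, by omega⟩ := rfl
        rw [e', this]
        exact ih _ _ _ _ hμ ((mem_scalarRec P e _ _).mp hν b)

theorem one_mem_scalarRec (P : Operad 𝕜) (e : P.obj 0) : P.one ∈ scalarRec P e 1 := by
  rw [mem_scalarRec P e (n := 0) rfl]
  intro i
  obtain rfl : i = 0 := Subsingleton.elim _ _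
  rw [P.one_comp]
  exact Submodule.mem_span_singleton_self e

theorem pois_mem_scalarRec {n : ℕ} (t : OpTerm 𝕜 PoisGen n) :
    presentedMk (PoisRel 𝕜) t ∈
      scalarRec (PoisOperad 𝕜) (presentedMk (PoisRel 𝕜) (unitT 𝕜)) n := by
  induction t with
  | gen g =>
    cases g with
    | unit => exact Submodule.mem_span_singleton_self _
    | mul =>
      rw [mem_scalarRec _ _ (n := 1) rfl]
      intro i
      have : (PoisOperad 𝕜).comp (m := 2) (n := 0) (r := 1) rfl i (presentedMk (PoisRel 𝕜) (mulT 𝕜))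
          (presentedMk (PoisRel 𝕜) (unitT 𝕜)) = (PoisOperad 𝕜).one :=
        Quotient.sound (.of (.mul_unit i))
      exact this ▸ one_mem_scalarRec _ _
    | br =>
      rw [mem_scalarRec _ _ (n := 1) rfl]
      intro i
      have : (PoisOperad 𝕜).comp (m := 2) (n := 0) (r := 1) rfl i (presentedMk (PoisRel 𝕜) (brT 𝕜))
          (presentedMk (PoisRel 𝕜) (unitT 𝕜)) = 0 :=
        Quotient.sound (.of (.br_unit i))
      exact this ▸ zero_mem _
  | one => exact one_mem_scalarRec _ _
  | zero n => exact zero_mem _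
  | add a b iha ihb => exact add_mem iha ihb
  | smul c a ih => exact Submodule.smul_mem _ c ih
  | act σ a ih => exact scalarRec_act _ _ σ _ ih
  | comp h i a b iha ihb => exact scalarRec_comp _ _ h i _ _ iha ihb

/-- The morphism `Pois → Com` killing the bracket. -/
def poisToCom : OperadHom (PoisOperad 𝕜) (Com 𝕜).toOperad :=
  presentedLift (Com 𝕜).toOperad
    (fun _ g => match g with
      | .unit => (1 : 𝕜)
      | .mul => (1 : 𝕜)
      | .br => (0 : 𝕜))
    (by
      intro n a b h
      cases h with
      | mul_unit i => exact mul_one (1 : 𝕜)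
      | br_unit i => exact zero_mul (1 : 𝕜)
      | mul_comm => rfl
      | br_skew => exact (mul_zero (-1 : 𝕜)).symm
      | mul_assoc => rfl
      | leibniz => exact (by simp : (0 : 𝕜) * 1 = 1 * 0 + 1 * 0)
      | jacobi => exact (by simp : (0 : 𝕜) * 0 = 0 * 0 + 0 * 0))

variable (𝕜)

/-- The operad `Pois` of unital commutative Poisson algebras. -/
def Pois : UnitaryOperad 𝕜 where
  toOperad := PoisOperad 𝕜
  unit0 := presentedMk (PoisRel 𝕜) (unitT 𝕜)
  unit0_basis := by
    constructor
    · intro a b hab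
      have h := congrArg (poisToCom.toFun 0) hab
      simp only [map_smul] at h
      have h1 : poisToCom.toFun 0 (presentedMk (PoisRel 𝕜) (unitT 𝕜)) = (1 : 𝕜) := rfl
      rw [h1] at h
      exact (mul_one a).symm.trans ((h : a * 1 = b * 1).trans (mul_one b))
    · rintro ⟨t⟩
      exact Submodule.mem_span_singleton.mp (pois_mem_scalarRec t)

end Pois

end Operadic

open Operadic

/-! The quotients are identified by comparison with explicit models. The truncation ideal has a
recursive description, `truncRec`: it is zero in arities below `k`, and from arity `k` on an
operation belongs to it exactly when every insertion of the unit `1_0` into one slot does. Hence a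
unit-preserving morphism that is injective in arities below `k` pulls the `k`-th truncation ideal of
its target back to that of its source (`map_mem_truncRec`). If it is also surjective and the ideal
of the target vanishes, its kernel is the truncation ideal, and the target is the quotient
(`modTrunc_iso`).

For `k = 1, 2` the model is `Com`: `As` and `Pois` have rank one in arities `0` and `1`, and
inserting the unit loses nothing in `Com`. A derivation of `Com` is multiplication by a scalar in
each arity; the Leibniz rule makes this scalar a multiple of `1 - n`, which is the inner derivation
of a scalar (`com_h1`).

For `k = 3` the model is `Alt`: a scalar plus an alternating function of two slots, where the
product of two such functions is zero. `Pois` maps to it by sending the product to the scalar `1`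
and the bracket to the elementary form. `As` maps to it by sending a permutation to `1` plus one
half of the sign of the relative order of each pair of variables, which reflects `xy = (xy + yx)/2 +
[x, y]/2`. Both maps are bijective in arities at most `2`, the first one because `Pois(2)` is
spanned by product and bracket (`pois_mem_lowSpan`), the second because `2` is invertible. Since
`Alt` is generated in arities `0` and `2` and its third truncation ideal is zero, both third
truncations are `Alt`. A derivation of `Alt` is determined in arities below `3`; an inner one
corrects its value on the unit, commutativity then kills its value on the product when `2 ≠ 0`, and
the scaling of the bracket is the one remaining parameter (`alt_h1`).

The negative statements use the product of `Pois`. For `k ≥ 3` an isomorphism yields a commutative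
operation with a unit in `As(2)`, necessarily `a(xy + yx)`, and inserting the unit gives `2ac = 1`
for some `c`; this excludes characteristic `2`. For `k ≥ 4` arity `3` survives as well, so this
operation is associative, and counting words with the first variable in the middle gives `2a² = 0`,
contradicting `2ac = 1`. -/

namespace Operadic

/-! ### Isomorphisms of operads and invariance of the first cohomology -/

section Morphisms

variable {𝕜 : Type u} [CommRing 𝕜] {P Q R : Operad 𝕜}

/-- The composite of two morphisms of operads. -/
def OperadHom.trans (f : OperadHom P Q) (g : OperadHom Q R) : OperadHom P R where
  toFun n := (g.toFun n).comp (f.toFun n)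
  map_one := by simp [f.map_one, g.map_one]
  map_act σ θ := by simp [f.map_act, g.map_act]
  map_comp h i μ ν := by simp [f.map_comp, g.map_comp]

theorem OperadIso.trans (h : OperadIso P Q) (h' : OperadIso Q R) : OperadIso P R := by
  obtain ⟨f, hf⟩ := h
  obtain ⟨g, hg⟩ := h'
  refine ⟨f.trans g, fun n => ?_⟩
  exact (hg n).comp (hf n)

theorem OperadIso.symm (h : OperadIso P Q) : OperadIso Q P := by
  obtain ⟨f, hf⟩ := h
  let e : ∀ n, P.obj n ≃ₗ[𝕜] Q.obj n := fun n => LinearEquiv.ofBijective (f.toFun n) (hf n)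
  have he : ∀ n x, e n x = f.toFun n x := fun n x => rfl
  refine ⟨⟨fun n => (e n).symm, ?_, ?_, ?_⟩, fun n => (e n).symm.bijective⟩
  · exact (LinearEquiv.symm_apply_eq _).mpr f.map_one.symm
  · intro n σ θ
    refine (LinearEquiv.symm_apply_eq _).mpr ?_
    rw [he, f.map_act, ← he]
    exact congrArg _ ((e n).apply_symm_apply θ).symm
  · intro m n r h i μ ν
    refine (LinearEquiv.symm_apply_eq _).mpr ?_
    rw [he, f.map_comp, ← he, ← he]
    exact congrArg₂ (fun x y => Q.comp h i x y) ((e m).apply_symm_apply μ).symm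
      ((e n).apply_symm_apply ν).symm

/-- The first cohomology groups of isomorphic operads are isomorphic. -/
theorem OperadIso.h1_equiv (h : OperadIso P Q) : Nonempty (P.H1 ≃ₗ[𝕜] Q.H1) := by
  obtain ⟨f, hf⟩ := h
  let e : ∀ n, P.obj n ≃ₗ[𝕜] Q.obj n := fun n => LinearEquiv.ofBijective (f.toFun n) (hf n)
  -- Conjugation by the isomorphism. It will match derivations with derivations, and the inner
  -- derivation of `a` with that of the image of `a`.
  let c : (∀ n, P.obj n →ₗ[𝕜] P.obj n) ≃ₗ[𝕜] ∀ n, Q.obj n →ₗ[𝕜] Q.obj n :=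
    LinearEquiv.piCongrRight fun n => (e n).conj
  have hc : ∀ d n x, c d n (f.toFun n x) = f.toFun n (d n x) := by
    intro d n x
    change e n (d n ((e n).symm (e n x))) = e n (d n x)
    rw [LinearEquiv.symm_apply_apply]
  have hder : ∀ d, c d ∈ Q.der ↔ d ∈ P.der := by
    intro d
    constructor
    · rintro ⟨h1, h2⟩
      refine ⟨fun n σ θ => (hf n).1 ?_, fun m n r h i μ ν => (hf r).1 ?_⟩
      · rw [f.map_act, ← hc, ← hc, f.map_act, h1]
      · rw [map_add, f.map_comp, f.map_comp, ← hc, ← hc, ← hc, f.map_comp, h2]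
    · rintro ⟨h1, h2⟩
      refine ⟨fun n σ θ => ?_, fun m n r h i μ ν => ?_⟩
      · obtain ⟨θ, rfl⟩ := (hf n).2 θ
        rw [← f.map_act, hc, hc, h1, f.map_act]
      · obtain ⟨μ, rfl⟩ := (hf m).2 μ
        obtain ⟨ν, rfl⟩ := (hf n).2 ν
        rw [← f.map_comp, hc, hc, hc, h2, map_add, f.map_comp, f.map_comp]
  have hinn : ∀ (d : ∀ n, P.obj n →ₗ[𝕜] P.obj n) (a : P.obj 1),
      (∀ (n : ℕ) (θ : Q.obj n), c d n θ =
        Q.comp (Nat.add_comm 1 n) 0 (f.toFun 1 a) θ - ∑ i : Fin n, Q.comp rfl i θ (f.toFun 1 a)) ↔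
      ∀ (n : ℕ) (θ : P.obj n), d n θ =
        P.comp (Nat.add_comm 1 n) 0 a θ - ∑ i : Fin n, P.comp rfl i θ a := by
    intro d a
    constructor
    · intro H n θ
      apply (hf n).1
      rw [← hc, H, map_sub, map_sum]
      simp only [f.map_comp]
    · intro H n θ
      obtain ⟨θ, rfl⟩ := (hf n).2 θ
      rw [hc, H, map_sub, map_sum]
      simp only [f.map_comp]
  let E : P.der ≃ₗ[𝕜] Q.der := c.ofSubmodules P.der Q.der (by
    ext d
    obtain ⟨d, rfl⟩ := c.surjective d
    rw [hder]
    exact ⟨fun ⟨d', h, h'⟩ => c.injective h' ▸ h, fun h => ⟨d, h, rfl⟩⟩)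
  refine ⟨Submodule.Quotient.equiv P.innerDer Q.innerDer E ?_⟩
  ext d
  obtain ⟨d, rfl⟩ := E.surjective d
  constructor
  · rintro ⟨d', ⟨a, ha⟩, h'⟩
    obtain rfl := E.injective h'
    exact ⟨f.toFun 1 a, (hinn d'.1 a).mpr ha⟩
  · rintro ⟨a, ha⟩
    obtain ⟨a, rfl⟩ := (hf 1).2 a
    exact ⟨d, ⟨a, (hinn d.1 a).mp ha⟩, rfl⟩

end Morphisms

/-! ### Truncation ideals under morphisms -/

namespace UnitaryOperad

variable {𝕜 : Type u} [CommRing 𝕜] {P Q : UnitaryOperad 𝕜}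

/-- A morphism of unitary operads that is injective in arities below `k` detects the `k`-th
truncation ideal. -/
theorem map_mem_truncRec (F : OperadHom P.toOperad Q.toOperad)
    (h0 : F.toFun 0 P.unit0 = Q.unit0) {k : ℕ}
    (hinj : ∀ n < k, Function.Injective (F.toFun n)) {n : ℕ} (θ : P.obj n) :
    F.toFun n θ ∈ Q.truncRec k n ↔ θ ∈ P.truncRec k n := by
  have low : ∀ n < k, ∀ θ : P.obj n,
      F.toFun n θ ∈ Q.truncRec k n ↔ θ ∈ P.truncRec k n := by
    intro n hn θ
    rw [truncRec_lt P hn, truncRec_lt Q hn, Submodule.mem_bot, Submodule.mem_bot]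
    exact map_eq_zero_iff _ (hinj n hn)
  induction n with
  | zero =>
    rcases Nat.eq_zero_or_pos k with rfl | hk
    · simp [truncRec_zero]
    · exact low 0 hk θ
  | succ n ih =>
    by_cases hn : n + 1 < k
    · exact low _ hn θ
    · rw [mem_truncRec P rfl (not_lt.mp hn), mem_truncRec Q rfl (not_lt.mp hn)]
      refine forall_congr' fun i => ?_
      have := ih (P.comp (m := n + 1) (n := 0) rfl i θ P.unit0)
      rwa [F.map_comp, h0] at this

/-- The quotient by the `k`-th truncation ideal, from a surjection onto an operad whose `k`-th
truncation ideal vanishes. -/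
theorem modTrunc_iso (F : OperadHom P.toOperad Q.toOperad)
    (h0 : F.toFun 0 P.unit0 = Q.unit0) {k : ℕ}
    (hinj : ∀ n < k, Function.Injective (F.toFun n))
    (hsurj : ∀ n, Function.Surjective (F.toFun n)) (hQ : ∀ n, Q.truncRec k n = ⊥) :
    OperadIso (P.modTrunc k) Q.toOperad := by
  -- As the truncation ideal of the target is zero, detecting the ideal of the source through `F`
  -- means lying in the kernel of `F`.
  have hker : ∀ n, (P.truncIdeal k).carrier n = LinearMap.ker (F.toFun n) := by
    intro n
    ext θ
    change θ ∈ P.truncSubmodule k n ↔ _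
    rw [truncSubmodule_eq, ← map_mem_truncRec F h0 hinj, hQ, Submodule.mem_bot, LinearMap.mem_ker]
  refine ⟨⟨fun n => ((P.truncIdeal k).carrier n).liftQ (F.toFun n) (hker n).le, F.map_one,
    ?_, ?_⟩, fun n => ⟨?_, ?_⟩⟩
  · intro n σ θ
    induction θ using Submodule.Quotient.induction_on with | _ θ
    exact F.map_act σ θ
  · intro m n r h i μ ν
    induction μ using Submodule.Quotient.induction_on with | _ μ
    induction ν using Submodule.Quotient.induction_on with | _ ν
    exact F.map_comp h i μ ν
  · exact LinearMap.ker_eq_bot.mp (Submodule.ker_liftQ_eq_bot _ _ _ (hker n).ge)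
  · intro y
    obtain ⟨x, rfl⟩ := hsurj n y
    exact ⟨Submodule.Quotient.mk x, rfl⟩

end UnitaryOperad

/-! ### The commutative operad: truncation ideals and cohomology -/

section Commutative

variable (𝕜 : Type u) [CommRing 𝕜]

/-- Inserting the unit in `Com` is multiplication by `1`, so no nonzero operation dies. For `k = 0`
the ideal would be everything. -/
theorem com_truncRec {k : ℕ} (hk : 0 < k) (n : ℕ) : (Com 𝕜).truncRec k n = ⊥ := by
  induction n with
  | zero => exact UnitaryOperad.truncRec_lt _ hk
  | succ n ih =>
    by_cases hn : n + 1 < k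
    · exact UnitaryOperad.truncRec_lt _ hn
    · rw [eq_bot_iff]
      intro θ hθ
      have := (UnitaryOperad.mem_truncRec (Com 𝕜) rfl (not_lt.mp hn) θ).mp hθ 0
      rw [ih, Submodule.mem_bot] at this
      rw [Submodule.mem_bot]
      exact (mul_one (M := 𝕜) θ).symm.trans this

/-- In arity `n` a derivation is multiplication by its value at `1`. Applied to the insertion of the
unit into arity `n + 1`, the Leibniz rule shows that this value drops by the value in arity `0` at
each step; as it starts there, it is `1 - n` times that value `λ`. The inner derivation of `λ` has
the same factor: one composition on the left minus `n` on the right. -/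
theorem com_h1 : Subsingleton (Com 𝕜).toOperad.H1 := by
  rw [Submodule.Quotient.subsingleton_iff, eq_top_iff]
  rintro ⟨d, hd, hd'⟩ -
  let D : ℕ → 𝕜 →ₗ[𝕜] 𝕜 := d
  have hD : ∀ m n r (_ : m + n = r + 1) (_ : Fin m) (a b : 𝕜),
      D r (a * b) = D m a * b + a * D n b := fun m n r h i a b => hd' m n r h i a b
  have hadd : ∀ m n r (_ : m + n = r + 1) (_ : Fin m), D r 1 = D m 1 + D n 1 := by
    intro m n r h i
    simpa using hD m n r h i 1 1
  have c1 : D 1 1 = 0 := by simpa using hadd 1 1 1 rfl 0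
  have c0 : ∀ n, D n 1 = (1 - n) * D 0 1 := by
    intro n
    induction n with
    | zero => simp
    | succ n ih =>
      have h := hadd (n + 1) 0 n rfl 0
      push_cast
      linear_combination ih - h
  refine ⟨D 0 1, fun n θ => ?_⟩
  have key : ∀ x : 𝕜, D n x = D 0 1 * x - ∑ i : Fin n, x * D 0 1 := by
    intro x
    have := map_smul (D n) x 1
    rw [smul_eq_mul, mul_one] at this
    rw [this, c0, Finset.sum_const, Finset.card_univ, Fintype.card_fin, nsmul_eq_mul, smul_eq_mul]
    ring
  exact key θ

end Commutative

/-! ### Slot combinatorics: collapsing a block and extending from a block -/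

section Collapse

/-- The map of slots that collapses the block of `n` slots replacing slot `i` to `i`. -/
def collapse {m n r : ℕ} (h : m + n = r + 1) (i : Fin m) (x : Fin r) : Fin m :=
  ⟨if x.1 < i.1 then x.1 else if x.1 < i.1 + n then i.1 else x.1 + 1 - n, by
    split_ifs <;> omega⟩

theorem collapse_val {m n r : ℕ} (h : m + n = r + 1) (i : Fin m) (x : Fin r) :
    (collapse h i x).1 =
      if x.1 < i.1 then x.1 else if x.1 < i.1 + n then i.1 else x.1 + 1 - n := rfl

theorem collapse_outer {m n r : ℕ} (h : m + n = r + 1) (i a : Fin m) (ha : a ≠ i) :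
    collapse h i (outerPos h i a ha) = a := by
  have := Fin.val_ne_of_ne ha
  ext
  rw [collapse_val, outerPos_val]
  unfold shift
  split_ifs <;> omega

theorem collapse_inner {m n r : ℕ} (h : m + n = r + 1) (i : Fin m) (b : Fin n) :
    collapse h i (innerPos h i b) = i := by
  ext
  rw [collapse_val, innerPos_val]
  split_ifs <;> omega

/-- A composite permutation moves the block at `i` as a whole to the block at `φ i`, so it induces
`φ` on the collapsed slots. This gives the equivariance axioms of `Alt`. -/
theorem collapse_permComp {m n r : ℕ} (h : m + n = r + 1) (i : Fin m) (φ : Equiv.Perm (Fin m))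
    (σ : Equiv.Perm (Fin n)) (x : Fin r) :
    collapse h (φ i) (permComp h i φ σ x) = φ (collapse h i x) := by
  rcases pos_cases h i x with ⟨a, ha, rfl⟩ | ⟨b, rfl⟩
  · rw [permComp_outer, collapse_outer, collapse_outer]
  · rw [permComp_inner, collapse_inner, collapse_inner]

/-- For nested blocks, collapsing the small one and then the enlarged middle one is the same as
collapsing the large block at once. This and the lemmas below on nested and disjoint blocks are the
two composition axioms of `Alt`, term by term. -/
theorem collapse_collapse {l m n p q r : ℕ} (hp : l + m = p + 1) (hr : p + n = r + 1)
    (hq : m + n = q + 1) (hr' : l + q = r + 1) (i : Fin l) (j : Fin m) (x : Fin r) :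
    collapse hp i (collapse hr ⟨i + j, by omega⟩ x) = collapse hr' i x := by
  ext
  simp only [collapse_val]
  split_ifs <;> omega

theorem collapse_comm {l m n p q r : ℕ} (hp : l + m = p + 1) (hr : p + n = r + 1)
    (hq : l + n = q + 1) (hr' : q + m = r + 1) (i j : Fin l) (hij : i < j) (x : Fin r) :
    collapse hp i (collapse hr ⟨j + m - 1, by omega⟩ x) =
      collapse hq j (collapse hr' ⟨i, by omega⟩ x) := by
  have hij' : i.1 < j.1 := hij
  ext
  simp only [collapse_val]
  split_ifs <;> omega

variable {𝕜 : Type u} [CommRing 𝕜]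

/-- Extension by zero of a function of two slots in the block replacing slot `i`. -/
def extendInner {m n r : ℕ} (_h : m + n = r + 1) (i : Fin m) (g : Fin n → Fin n → 𝕜)
    (x y : Fin r) : 𝕜 :=
  if hxy : (i.1 ≤ x.1 ∧ x.1 < i.1 + n) ∧ i.1 ≤ y.1 ∧ y.1 < i.1 + n then
    g ⟨x.1 - i.1, by omega⟩ ⟨y.1 - i.1, by omega⟩ else 0

theorem extendInner_inner {m n r : ℕ} (h : m + n = r + 1) (i : Fin m) (g : Fin n → Fin n → 𝕜)
    (b c : Fin n) : extendInner h i g (innerPos h i b) (innerPos h i c) = g b c := by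
  simp [extendInner, innerPos_val]

theorem extendInner_outer_left {m n r : ℕ} (h : m + n = r + 1) (i : Fin m)
    (g : Fin n → Fin n → 𝕜) (a : Fin m) (ha : a ≠ i) (y : Fin r) :
    extendInner h i g (outerPos h i a ha) y = 0 := by
  have := Fin.val_ne_of_ne ha
  apply dif_neg
  rw [outerPos_val]
  unfold shift
  split_ifs <;> omega

theorem extendInner_outer_right {m n r : ℕ} (h : m + n = r + 1) (i : Fin m)
    (g : Fin n → Fin n → 𝕜) (a : Fin m) (ha : a ≠ i) (x : Fin r) :
    extendInner h i g x (outerPos h i a ha) = 0 := by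
  have := Fin.val_ne_of_ne ha
  apply dif_neg
  rw [outerPos_val]
  unfold shift
  split_ifs <;> omega

theorem extendInner_permComp {m n r : ℕ} (h : m + n = r + 1) (i : Fin m)
    (g : Fin n → Fin n → 𝕜) (φ : Equiv.Perm (Fin m)) (σ : Equiv.Perm (Fin n)) (x y : Fin r) :
    extendInner h (φ i) g (permComp h i φ σ x) (permComp h i φ σ y) =
      extendInner h i (fun b c => g (σ b) (σ c)) x y := by
  rcases pos_cases h i x with ⟨a, ha, rfl⟩ | ⟨b, rfl⟩
  · rw [permComp_outer, extendInner_outer_left, extendInner_outer_left]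
  · rcases pos_cases h i y with ⟨a, ha, rfl⟩ | ⟨c, rfl⟩
    · rw [permComp_outer, extendInner_outer_right, extendInner_outer_right]
    · rw [permComp_inner, permComp_inner, extendInner_inner, extendInner_inner]

theorem extendInner_extendInner {l m n p q r : ℕ} (hp : l + m = p + 1) (hr : p + n = r + 1)
    (hq : m + n = q + 1) (hr' : l + q = r + 1) (i : Fin l) (j : Fin m)
    (g : Fin n → Fin n → 𝕜) (x y : Fin r) :
    extendInner hr ⟨i + j, by omega⟩ g x y = extendInner hr' i (extendInner hq j g) x y := by
  unfold extendInner
  dsimp only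
  split_ifs
  · congr 2 <;> omega
  all_goals first | rfl | omega

theorem extendInner_collapse {l m n p q r : ℕ} (hp : l + m = p + 1) (hr : p + n = r + 1)
    (hq : m + n = q + 1) (hr' : l + q = r + 1) (i : Fin l) (j : Fin m)
    (g : Fin m → Fin m → 𝕜) (x y : Fin r) :
    extendInner hp i g (collapse hr ⟨i + j, by omega⟩ x) (collapse hr ⟨i + j, by omega⟩ y) =
      extendInner hr' i (fun b c => g (collapse hq j b) (collapse hq j c)) x y := by
  -- The preimage of the middle block under the collapse of the block nested in it is the large
  -- block of `q` slots.
  have key : ∀ x : Fin r, (i.1 ≤ (collapse hr ⟨i + j, by omega⟩ x).1 ∧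
      (collapse hr ⟨i + j, by omega⟩ x).1 < i.1 + m) ↔ (i.1 ≤ x.1 ∧ x.1 < i.1 + q) := by
    intro x
    simp only [collapse_val]
    split_ifs <;> omega
  unfold extendInner
  simp only [key]
  split_ifs with H
  · congr 1 <;> ext <;> simp only [collapse_val] <;> split_ifs <;> omega
  · rfl

theorem extendInner_collapse_comm {l m n p q r : ℕ} (hp : l + m = p + 1) (hr : p + n = r + 1)
    (hq : l + n = q + 1) (hr' : q + m = r + 1) (i j : Fin l) (hij : i < j)
    (g : Fin m → Fin m → 𝕜) (x y : Fin r) :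
    extendInner hp i g (collapse hr ⟨j + m - 1, by omega⟩ x)
      (collapse hr ⟨j + m - 1, by omega⟩ y) = extendInner hr' ⟨i, by omega⟩ g x y := by
  have hij' : i.1 < j.1 := hij
  -- The block at `j` lies to the right of the block at `i`, so collapsing it leaves the block at
  -- `i` in place.
  have key : ∀ x : Fin r, (i.1 ≤ (collapse hr ⟨j + m - 1, by omega⟩ x).1 ∧
      (collapse hr ⟨j + m - 1, by omega⟩ x).1 < i.1 + m) ↔ (i.1 ≤ x.1 ∧ x.1 < i.1 + m) := by
    intro x
    simp only [collapse_val]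
    split_ifs <;> omega
  unfold extendInner
  simp only [key]
  split_ifs with H
  · congr 1 <;> ext <;> simp only [collapse_val] <;> split_ifs <;> omega
  · rfl

theorem extendInner_comm_collapse {l m n p q r : ℕ} (hp : l + m = p + 1) (hr : p + n = r + 1)
    (hq : l + n = q + 1) (hr' : q + m = r + 1) (i j : Fin l) (hij : i < j)
    (g : Fin n → Fin n → 𝕜) (x y : Fin r) :
    extendInner hr ⟨j + m - 1, by omega⟩ g x y =
      extendInner hq j g (collapse hr' ⟨i, by omega⟩ x) (collapse hr' ⟨i, by omega⟩ y) := by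
  have hij' : i.1 < j.1 := hij
  -- Here the collapsed block lies to the left, so the block at `j` is found shifted by `m - 1`.
  have key : ∀ x : Fin r, (j.1 ≤ (collapse hr' ⟨i, by omega⟩ x).1 ∧
      (collapse hr' ⟨i, by omega⟩ x).1 < j.1 + n) ↔
      (j.1 + m - 1 ≤ x.1 ∧ x.1 < j.1 + m - 1 + n) := by
    intro x
    simp only [collapse_val]
    split_ifs <;> omega
  unfold extendInner
  simp only [key]
  split_ifs with H
  · congr 1 <;> ext <;> simp only [collapse_val] <;> split_ifs <;> omega
  · rfl

end Collapse

/-! ### The operad of alternating forms -/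

section AltForm

variable (𝕜 : Type u) [CommRing 𝕜]

/-- Alternating functions of two slots. -/
def altForm (n : ℕ) : Submodule 𝕜 (Fin n → Fin n → 𝕜) where
  -- The vanishing on the diagonal is imposed separately because antisymmetry does not imply it in
  -- characteristic `2`.
  carrier := {f | (∀ x, f x x = 0) ∧ ∀ x y, f x y = -f y x}
  zero_mem' := by simp
  add_mem' := by
    rintro f g ⟨hf, hf'⟩ ⟨hg, hg'⟩
    refine ⟨fun x => by simp [hf, hg], fun x y => ?_⟩
    simp only [Pi.add_apply]
    rw [hf' x y, hg' x y]
    ring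
  smul_mem' := by
    rintro c f ⟨hf, hf'⟩
    refine ⟨fun x => by simp [hf], fun x y => ?_⟩
    simp only [Pi.smul_apply, smul_eq_mul]
    rw [hf' x y]
    ring

variable {𝕜}

/-- Pulling back an alternating function along a map of slots. -/
def altPull {m r : ℕ} (p : Fin r → Fin m) : altForm 𝕜 m →ₗ[𝕜] altForm 𝕜 r where
  toFun f := ⟨fun x y => f.1 (p x) (p y), fun _ => f.2.1 _, fun _ _ => f.2.2 _ _⟩
  map_add' _ _ := rfl
  map_smul' _ _ := rfl

/-- Extending an alternating function by zero from the block of slots replacing slot `i`. -/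
def altExtend {m n r : ℕ} (h : m + n = r + 1) (i : Fin m) : altForm 𝕜 n →ₗ[𝕜] altForm 𝕜 r where
  toFun g := ⟨extendInner h i g.1, by
    constructor
    · intro x
      unfold extendInner
      split_ifs
      · exact g.2.1 _
      · rfl
    · intro x y
      unfold extendInner
      simp only [and_comm (a := i.1 ≤ y.1 ∧ _)]
      split_ifs
      · exact g.2.2 _ _
      · exact neg_zero.symm⟩
  map_add' f g := by
    ext x y
    change extendInner h i (f.1 + g.1) x y = extendInner h i f.1 x y + extendInner h i g.1 x y
    unfold extendInner
    split_ifs <;> simp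
  map_smul' c f := by
    ext x y
    change extendInner h i (c • f.1) x y = c * extendInner h i f.1 x y
    unfold extendInner
    split_ifs <;> simp

theorem altPull_apply {m r : ℕ} (p : Fin r → Fin m) (f : altForm 𝕜 m) (x y : Fin r) :
    (altPull p f).1 x y = f.1 (p x) (p y) := rfl

theorem altForm_ext {n : ℕ} {f g : altForm 𝕜 n} (h : ∀ x y, f.1 x y = g.1 x y) : f = g :=
  Subtype.ext (funext fun x => funext fun y => h x y)

variable (𝕜)

/-- The partial compositions of the operad of alternating forms. -/
def altComp {m n r : ℕ} (h : m + n = r + 1) (i : Fin m) :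
    𝕜 × altForm 𝕜 m →ₗ[𝕜] 𝕜 × altForm 𝕜 n →ₗ[𝕜] 𝕜 × altForm 𝕜 r :=
  LinearMap.mk₂ 𝕜
    -- The form of a composite obeys a product rule: a pair of slots in different places is seen by
    -- the outer form, a pair inside the block by the inner one. The product of the two forms is
    -- dropped.
    (fun μ ν => (μ.1 * ν.1, ν.1 • altPull (collapse h i) μ.2 + μ.1 • altExtend h i ν.2))
    (by
      intro a b c
      ext1
      · simp [add_mul]
      · simp only [Prod.fst_add, Prod.snd_add, map_add]; module)
    (by
      intro a b c
      ext1
      · simp [mul_assoc]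
      · simp only [Prod.smul_fst, Prod.smul_snd, map_smul, smul_eq_mul]; module)
    (by
      intro a b c
      ext1
      · simp [mul_add]
      · simp only [Prod.fst_add, Prod.snd_add, map_add]; module)
    (by
      intro a b c
      ext1
      · simp [mul_left_comm]
      · simp only [Prod.smul_fst, Prod.smul_snd, map_smul, smul_eq_mul]; module)

variable {𝕜}

theorem altComp_apply {m n r : ℕ} (h : m + n = r + 1) (i : Fin m) (μ : 𝕜 × altForm 𝕜 m)
    (ν : 𝕜 × altForm 𝕜 n) : altComp 𝕜 h i μ ν =
      (μ.1 * ν.1, ν.1 • altPull (collapse h i) μ.2 + μ.1 • altExtend h i ν.2) := rfl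

theorem alt_prod_ext {n : ℕ} {μ ν : 𝕜 × altForm 𝕜 n} (h : μ.1 = ν.1)
    (h' : ∀ x y, μ.2.1 x y = ν.2.1 x y) : μ = ν :=
  Prod.ext h (altForm_ext h')

theorem altComp_snd {m n r : ℕ} (h : m + n = r + 1) (i : Fin m) (μ : 𝕜 × altForm 𝕜 m)
    (ν : 𝕜 × altForm 𝕜 n) (x y : Fin r) : (altComp 𝕜 h i μ ν).2.1 x y =
      ν.1 * μ.2.1 (collapse h i x) (collapse h i y) + μ.1 * extendInner h i ν.2.1 x y := rfl

theorem altComp_fst {m n r : ℕ} (h : m + n = r + 1) (i : Fin m) (μ : 𝕜 × altForm 𝕜 m)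
    (ν : 𝕜 × altForm 𝕜 n) : (altComp 𝕜 h i μ ν).1 = μ.1 * ν.1 := rfl

theorem extendInner_add_mul {m n r : ℕ} (h : m + n = r + 1) (i : Fin m)
    (a b : 𝕜) (f g : Fin n → Fin n → 𝕜) (x y : Fin r) :
    extendInner h i (fun u v => a * f u v + b * g u v) x y =
      a * extendInner h i f x y + b * extendInner h i g x y := by
  unfold extendInner
  split_ifs <;> simp

/-- In arities `0` and `1` there is no pair of distinct slots, so only the scalar remains. In arity
`0` this makes `Alt` unitary; in arity `1` every operation is a multiple of the identity. -/
instance : Subsingleton (altForm 𝕜 0) := ⟨fun _ _ => altForm_ext fun x => x.elim0⟩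

instance : Subsingleton (altForm 𝕜 1) := ⟨fun f g => altForm_ext fun x y => by
  rw [Subsingleton.elim y x, f.2.1, g.2.1]⟩

variable (𝕜)

/-- The operad of alternating forms: a scalar together with an alternating function of two slots,
where composition is the square-zero one. -/
def Alt : UnitaryOperad 𝕜 where
  obj n := 𝕜 × altForm 𝕜 n
  act σ := LinearMap.prodMap LinearMap.id (altPull σ)
  one := (1, 0)
  comp h i := altComp 𝕜 h i
  act_one _ := rfl
  act_mul _ _ _ := rfl
  comp_one i θ := by
    refine alt_prod_ext (mul_one _) fun x y => ?_
    have hc : ∀ z, collapse (n := 1) rfl i z = z := fun z => by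
      ext; rw [collapse_val]; split_ifs <;> omega
    rw [altComp_snd, hc, hc]
    simp [extendInner]
  one_comp {n} h θ := by
    refine alt_prod_ext (one_mul _) fun x y => ?_
    rw [altComp_snd]
    simp [extendInner]
  comp_assoc hp hr hq hr' i j a b c := by
    refine alt_prod_ext (mul_assoc _ _ _) fun x y => ?_
    rw [altComp_snd, altComp_snd, altComp_snd]
    have : (altComp 𝕜 hq j b c).2.1 = fun u v =>
      c.1 * b.2.1 (collapse hq j u) (collapse hq j v) + b.1 * extendInner hq j c.2.1 u v := by
      funext u v; exact altComp_snd _ _ _ _ _ _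
    rw [this, extendInner_add_mul, collapse_collapse hp hr hq hr', collapse_collapse hp hr hq hr',
      extendInner_collapse hp hr hq hr', extendInner_extendInner hp hr hq hr', altComp_fst,
      altComp_fst]
    ring
  comp_comm hp hr hq hr' i j hij a b c := by
    refine alt_prod_ext (mul_right_comm _ _ _) fun x y => ?_
    rw [altComp_snd, altComp_snd, altComp_snd, altComp_snd, collapse_comm hp hr hq hr' i j hij,
      collapse_comm hp hr hq hr' i j hij, extendInner_collapse_comm hp hr hq hr' i j hij,
      extendInner_comm_collapse hp hr hq hr' i j hij, altComp_fst, altComp_fst]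
    ring
  comp_act h i μ ν σ := by
    refine alt_prod_ext rfl fun x y => ?_
    have e1 := collapse_permComp h i 1 σ
    have e2 := extendInner_permComp h i ν.2.1 1 σ
    rw [Equiv.Perm.one_apply] at e1 e2
    simp only [LinearMap.prodMap_apply, LinearMap.id_apply, altComp_snd, altPull_apply, e1, e2]
    rfl
  act_comp h i μ ν φ := by
    refine alt_prod_ext rfl fun x y => ?_
    have e1 := collapse_permComp h i φ 1
    have e2 := extendInner_permComp h i ν.2.1 φ 1
    simp only [LinearMap.prodMap_apply, LinearMap.id_apply, altComp_snd, altPull_apply, e1, e2]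
    rfl
  unit0 := (1, 0)
  unit0_basis := by
    constructor
    · intro a b h
      simpa using congrArg Prod.fst h
    · intro θ
      exact ⟨θ.1, Prod.ext (mul_one _) (Subsingleton.elim _ _)⟩

end AltForm

/-! ### Derivations that scale by arity, and rigidity under truncation -/

section ScalarDerivation

variable {𝕜 : Type u} [CommRing 𝕜]

/-- The derivation multiplying the operations of arity `n` by `(1 - n) c`. -/
def arityDer (P : Operad 𝕜) (c : 𝕜) : P.der :=
  ⟨fun n => ((1 - (n : 𝕜)) * c) • LinearMap.id, by
    refine ⟨fun n σ θ => by simp, fun m n r h i μ ν => ?_⟩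
    -- The Leibniz rule amounts to `(1 - m) + (1 - n) = 1 - r`.
    have h' : (m : 𝕜) + n = r + 1 := by exact_mod_cast congrArg (Nat.cast (R := 𝕜)) h
    simp only [LinearMap.smul_apply, LinearMap.id_apply, map_smul, ← add_smul]
    congr 1
    linear_combination c * h'⟩

theorem arityDer_apply (P : Operad 𝕜) (c : 𝕜) (n : ℕ) (θ : P.obj n) :
    (arityDer P c).1 n θ = ((1 - (n : 𝕜)) * c) • θ := rfl

/-- The identity is inserted once on the left and `n` times on the right, each time reproducing `θ`.
-/
theorem inner_smul_one (P : Operad 𝕜) (c : 𝕜) (n : ℕ) (θ : P.obj n) :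
    P.comp (Nat.add_comm 1 n) 0 (c • P.one) θ - ∑ i : Fin n, P.comp rfl i θ (c • P.one) =
      (arityDer P c).1 n θ := by
  rw [arityDer_apply, map_smul, LinearMap.smul_apply, P.one_comp]
  simp only [map_smul, P.comp_one, Finset.sum_const, Finset.card_univ, Fintype.card_fin]
  rw [← Nat.cast_smul_eq_nsmul 𝕜]
  module

theorem arityDer_mem_innerDer (P : Operad 𝕜) (c : 𝕜) : arityDer P c ∈ P.innerDer :=
  ⟨c • P.one, fun n θ => (inner_smul_one P c n θ).symm⟩

/-- Applying `d` to `1 ∘ 1 = 1` gives `d(1) = d(1) + d(1)`. -/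
theorem der_one (P : Operad 𝕜) (d : P.der) : d.1 1 P.one = 0 := by
  have := d.2.2 1 1 1 rfl 0 P.one P.one
  rw [P.comp_one, P.comp_one, P.one_comp] at this
  exact left_eq_add.mp this

/-- A derivation of a unitary operad whose `k`-th truncation ideal vanishes is determined by
its values in arities below `k`. -/
theorem der_eq_zero (P : UnitaryOperad 𝕜) {k : ℕ} (hk : 0 < k) (hP : ∀ n, P.truncRec k n = ⊥)
    (d : P.toOperad.der) (hd : ∀ n < k, d.1 n = 0) : d = 0 := by
  have : ∀ n, d.1 n = 0 := by
    intro n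
    induction n with
    | zero => exact hd 0 hk
    | succ n ih =>
      by_cases hn : n + 1 < k
      · exact hd _ hn
      · ext θ
        -- Since `d` kills the unit, it commutes with its insertion. The arity drops, so by
        -- induction every insertion of the unit into `d θ` vanishes.
        have : d.1 (n + 1) θ ∈ P.truncRec k (n + 1) := by
          rw [UnitaryOperad.mem_truncRec P rfl (not_lt.mp hn)]
          intro i
          have h := d.2.2 (n + 1) 0 n rfl i θ P.unit0
          rw [ih, hd 0 hk, LinearMap.zero_apply, LinearMap.zero_apply, map_zero, add_zero] at h
          rw [← h]
          exact zero_mem _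
        rw [hP, Submodule.mem_bot] at this
        exact this
  exact Subtype.ext (funext this)

end ScalarDerivation

/-! ### Third truncation ideal and generation of the operad of alternating forms -/

section Alternating

variable {𝕜 : Type u} [CommRing 𝕜]

theorem exists_ne_ne {n : ℕ} (hn : 3 ≤ n) (x y : Fin n) : ∃ i, x ≠ i ∧ y ≠ i := by
  by_contra! H
  have : (Finset.univ : Finset (Fin n)) ⊆ {x, y} := fun i _ => by
    by_cases h : x = i
    · simp [h]
    · simp [H i h]
  have := (Finset.card_le_card this).trans Finset.card_le_two
  rw [Finset.card_univ, Fintype.card_fin] at this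
  omega

/-- The value of a form at a pair of slots survives filling any other slot with the unit, and from
arity `3` on there is such a slot. -/
theorem alt_truncRec (n : ℕ) : (Alt 𝕜).truncRec 3 n = ⊥ := by
  induction n with
  | zero => exact UnitaryOperad.truncRec_lt _ (by omega)
  | succ n ih =>
    by_cases hn : n + 1 < 3
    · exact UnitaryOperad.truncRec_lt _ hn
    · rw [eq_bot_iff]
      intro θ hθ
      rw [UnitaryOperad.mem_truncRec (Alt 𝕜) rfl (not_lt.mp hn)] at hθ
      simp only [ih, Submodule.mem_bot] at hθ
      rw [Submodule.mem_bot]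
      have hθ' : ∀ i, altComp 𝕜 (n := 0) rfl i θ (1, 0) = 0 := hθ
      have h1 : θ.1 = 0 := (mul_one θ.1).symm.trans (congrArg Prod.fst (hθ' 0))
      refine alt_prod_ext h1 fun x y => ?_
      obtain ⟨i, hx, hy⟩ := exists_ne_ne (not_lt.mp hn) x y
      have := congrArg (fun f => f.2.1 (outerPos (n := 0) (r := n) rfl i x hx)
        (outerPos (n := 0) (r := n) rfl i y hy)) (hθ' i)
      have := (altComp_snd _ _ _ _ _ _).symm.trans this
      rw [collapse_outer, collapse_outer, h1, zero_mul, add_zero, one_mul] at this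
      exact this

/-- The elementary alternating function of two slots. -/
def altBasis {n : ℕ} (x y : Fin n) : altForm 𝕜 n :=
  ⟨fun u v => (if u = x ∧ v = y then 1 else 0) - if u = y ∧ v = x then 1 else 0, by
    refine ⟨fun u => ?_, fun u v => ?_⟩
    · simp only [and_comm, sub_self]
    · simp only [neg_sub, and_comm]⟩

theorem altBasis_apply {n : ℕ} (x y u v : Fin n) : (altBasis (𝕜 := 𝕜) x y).1 u v =
    (if u = x ∧ v = y then 1 else 0) - if u = y ∧ v = x then 1 else 0 := rfl

theorem altForm_eq_sum {n : ℕ} (f : altForm 𝕜 n) :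
    f = ∑ x, ∑ y, if x < y then f.1 x y • altBasis x y else 0 := by
  refine altForm_ext fun u v => ?_
  have : (∑ x, ∑ y, if x < y then f.1 x y • altBasis (𝕜 := 𝕜) x y else 0).1 u v =
      ∑ x, ∑ y, if x < y then f.1 x y * (altBasis (𝕜 := 𝕜) x y).1 u v else 0 := by
    simp only [AddSubmonoidClass.coe_finsetSum, Finset.sum_apply]
    refine Finset.sum_congr rfl fun x _ => Finset.sum_congr rfl fun y _ => ?_
    split_ifs <;> rfl
  rw [this]
  -- At `(u, v)` the double sum splits into two with at most one term each: the first contributes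
  -- when `u < v`, the second when `v < u`, and antisymmetry gives the right sign there.
  have e : ∀ x y : Fin n, (if x < y then f.1 x y * (altBasis (𝕜 := 𝕜) x y).1 u v else 0) =
      (if u = x then (if v = y then (if x < y then f.1 x y else 0) else 0) else 0) -
      (if v = x then (if u = y then (if x < y then f.1 x y else 0) else 0) else 0) := by
    intro x y
    rw [altBasis_apply]
    simp only [ite_and]
    split_ifs <;> ring
  simp only [e, Finset.sum_sub_distrib, Finset.sum_ite_eq, Finset.sum_ite_irrel,
    Finset.sum_const_zero, Finset.mem_univ, if_true]
  rcases lt_trichotomy u v with h | rfl | h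
  · simp [h, h.not_gt]
  · simp [f.2.1]
  · simp [h, h.not_gt, ← f.2.2 u v]

/-- Two transpositions suffice: one sends `x` to `x'`, the other corrects the image of `y` without
moving `x'`. -/
theorem exists_perm_pair {n : ℕ} {x y x' y' : Fin n} (h : x ≠ y) (h' : x' ≠ y') :
    ∃ σ : Equiv.Perm (Fin n), σ x = x' ∧ σ y = y' := by
  have hy : Equiv.swap x x' y ≠ x' := fun e => h (by
    have := congrArg (Equiv.swap x x') e
    rwa [Equiv.swap_apply_self, Equiv.swap_apply_right, eq_comm] at this)
  refine ⟨Equiv.swap (Equiv.swap x x' y) y' * Equiv.swap x x', ?_, ?_⟩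
  · rw [Equiv.Perm.mul_apply, Equiv.swap_apply_left, Equiv.swap_apply_of_ne_of_ne hy.symm h']
  · rw [Equiv.Perm.mul_apply, Equiv.swap_apply_left]

/-- The operad of alternating forms is generated in arities `0` and `2`. -/
theorem alt_surjective {P : Operad 𝕜} (F : OperadHom P (Alt 𝕜).toOperad)
    (h0 : Function.Surjective (F.toFun 0)) (h2 : Function.Surjective (F.toFun 2)) (n : ℕ) :
    Function.Surjective (F.toFun n) := by
  have hcomp : ∀ {m n r : ℕ} (h : m + n = r + 1) (i : Fin m) (μ : (Alt 𝕜).obj m)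
      (ν : (Alt 𝕜).obj n), μ ∈ LinearMap.range (F.toFun m) → ν ∈ LinearMap.range (F.toFun n) →
      (Alt 𝕜).comp h i μ ν ∈ LinearMap.range (F.toFun r) := by
    rintro m n r h i _ _ ⟨μ, rfl⟩ ⟨ν, rfl⟩
    exact ⟨P.comp h i μ ν, F.map_comp _ _ _ _⟩
  -- The iterated product, starting from the unit.
  have hone : ∀ n, ((1, 0) : 𝕜 × altForm 𝕜 n) ∈ LinearMap.range (F.toFun n) := by
    intro n
    induction n with
    | zero => exact h0 _
    | succ n ih =>
      have h : 2 + n = n + 1 + 1 := by omega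
      have e : altComp 𝕜 h 0 (1, 0) (1, 0) = (1, 0) :=
        Prod.ext (mul_one 1) (by simp [altComp_apply])
      have := hcomp h 0 _ _ (h2 (1, 0)) ih
      exact e ▸ this
  have hbasis : ∀ n (x y : Fin n), x ≠ y →
      ((0, altBasis x y) : 𝕜 × altForm 𝕜 n) ∈ LinearMap.range (F.toFun n) := by
    intro n x y hxy
    obtain ⟨n, rfl⟩ : ∃ n', n = n' + 2 := ⟨n - 2, by
      have := Fin.val_ne_of_ne hxy; omega⟩
    obtain ⟨σ, hx, hy⟩ := exists_perm_pair hxy (Fin.zero_ne_one (n := n))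
    -- The bracket of the first two variables, multiplied by all the others, has the elementary form
    -- of the slots `0, 1`. A permutation taking `x, y` to `0, 1` pulls it back to that of `x, y`.
    have h := hcomp (m := n + 1) (n := 2) (r := n + 2) rfl 0 _ _ (hone (n + 1))
      (h2 (0, altBasis 0 1))
    have e : (Alt 𝕜).comp (m := n + 1) (n := 2) (r := n + 2) rfl 0
        ((1, 0) : 𝕜 × altForm 𝕜 (n + 1)) ((0, altBasis 0 1) : 𝕜 × altForm 𝕜 2) =
        ((0, altBasis 0 1) : 𝕜 × altForm 𝕜 (n + 2)) := by
      refine alt_prod_ext (mul_zero (1 : 𝕜)) fun u v => ?_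
      refine (altComp_snd _ _ _ _ _ _).trans ?_
      rw [zero_mul, one_mul, zero_add]
      unfold extendInner
      split_ifs with H
      · rw [altBasis_apply, altBasis_apply]
        simp only [Fin.ext_iff, Fin.val_zero, Fin.val_one, Nat.sub_zero]
      · simp only [Fin.val_zero, zero_add, zero_le, true_and] at H
        rw [altBasis_apply, if_neg, if_neg, sub_zero]
        all_goals
          simp only [Fin.ext_iff, Fin.val_zero, Fin.val_one]
          omega
    rw [e] at h
    obtain ⟨θ, hθ⟩ := h
    refine ⟨P.act σ θ, ?_⟩
    rw [F.map_act, hθ]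
    refine alt_prod_ext rfl fun u v => ?_
    change (altBasis 0 1).1 (σ u) (σ v) = (altBasis x y).1 u v
    rw [altBasis_apply, altBasis_apply, ← hx, ← hy]
    simp only [σ.injective.eq_iff]
  intro θ
  suffices θ ∈ LinearMap.range (F.toFun n) from this
  have e : θ = θ.1 • ((1, 0) : 𝕜 × altForm 𝕜 n) +
      ∑ x, ∑ y, if x < y then θ.2.1 x y • ((0, altBasis x y) : 𝕜 × altForm 𝕜 n) else 0 := by
    have e1 := congrArg (LinearMap.inr 𝕜 𝕜 (altForm 𝕜 n)) (altForm_eq_sum θ.2)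
    have e2 : θ = θ.1 • ((1, 0) : 𝕜 × altForm 𝕜 n) + LinearMap.inr 𝕜 𝕜 (altForm 𝕜 n) θ.2 := by
      refine Prod.ext ?_ ?_
      · exact ((congrArg (· + (0 : 𝕜)) (mul_one θ.1)).trans (add_zero _)).symm
      · exact ((congrArg (· + θ.2) (smul_zero θ.1)).trans (zero_add _)).symm
    refine e2.trans ?_
    rw [e1]
    simp only [map_sum]
    congr 1
    refine Finset.sum_congr rfl fun x _ => Finset.sum_congr rfl fun y _ => ?_
    split_ifs
    · rw [map_smul]; rfl
    · rw [map_zero]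
  rw [e]
  refine add_mem (Submodule.smul_mem _ _ (hone n)) (sum_mem fun x _ => sum_mem fun y _ => ?_)
  split_ifs with h
  · exact Submodule.smul_mem _ _ (hbasis n x y h.ne)
  · exact zero_mem _

/-- A unitary operad with a morphism to the operad of alternating forms that is bijective in
arity at most two has that operad as its third truncation. -/
theorem modTrunc_three_iso {P : UnitaryOperad 𝕜} (F : OperadHom P.toOperad (Alt 𝕜).toOperad)
    (h0 : F.toFun 0 P.unit0 = (Alt 𝕜).unit0) (hinj : ∀ n < 3, Function.Injective (F.toFun n))
    (h2 : Function.Surjective (F.toFun 2)) :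
    OperadIso (P.modTrunc 3) (Alt 𝕜).toOperad := by
  refine UnitaryOperad.modTrunc_iso F h0 hinj (alt_surjective F ?_ h2) alt_truncRec
  intro y
  obtain ⟨c, rfl⟩ := (Alt 𝕜).unit0_basis.2 y
  exact ⟨c • P.unit0, by rw [map_smul, h0]⟩

end Alternating

/-! ### First cohomology of the operad of alternating forms -/

section AltCohomology

variable (𝕜 : Type u) [CommRing 𝕜]

/-- The derivation of the operad of alternating forms given by the degree in the form. -/
def altDegDer : (Alt 𝕜).toOperad.der :=
  ⟨fun n => (LinearMap.prodMap 0 LinearMap.id : 𝕜 × altForm 𝕜 n →ₗ[𝕜] 𝕜 × altForm 𝕜 n), by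
    refine ⟨fun n σ θ => rfl, fun m n r h i μ ν => ?_⟩
    -- Every term of the form of a composite contains exactly one of the two forms, so projecting
    -- onto forms satisfies the Leibniz rule.
    have : ∀ (μ : 𝕜 × altForm 𝕜 m) (ν : 𝕜 × altForm 𝕜 n),
        ((0, (altComp 𝕜 h i μ ν).2) : 𝕜 × altForm 𝕜 r) =
          altComp 𝕜 h i (0, μ.2) ν + altComp 𝕜 h i μ (0, ν.2) := by
      intro μ ν
      simp [altComp_apply]
    exact this μ ν⟩

/-- The bracket in the operad of alternating forms. -/
def altBr : (Alt 𝕜).obj 2 := ((0, altBasis 0 1) : 𝕜 × altForm 𝕜 2)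

/-- The product in the operad of alternating forms. -/
def altMul : (Alt 𝕜).obj 2 := ((1, 0) : 𝕜 × altForm 𝕜 2)

/-- The invariant of a derivation of the operad of alternating forms that vanishes on the inner
derivations. -/
def altDerInv : (Alt 𝕜).toOperad.der →ₗ[𝕜] 𝕜 where
  -- The bracket has arity `2` and the unit arity `0`, so on a derivation scaling arity `n` by `(1 -
  -- n) c` the two terms are `-c` and `c`.
  toFun d := (d.1 2 (altBr 𝕜)).2.1 0 1 + (d.1 0 (Alt 𝕜).unit0).1
  map_add' _ _ := add_add_add_comm _ _ _ _
  map_smul' c _ := (mul_add c _ _).symm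

variable {𝕜}

theorem altDerInv_apply (d : (Alt 𝕜).toOperad.der) :
    altDerInv 𝕜 d = (d.1 2 (altBr 𝕜)).2.1 0 1 + (d.1 0 (Alt 𝕜).unit0).1 := rfl

theorem altDerInv_altDegDer : altDerInv 𝕜 (altDegDer 𝕜) = 1 := by
  have : altDerInv 𝕜 (altDegDer 𝕜) = (altBasis (0 : Fin 2) 1).1 0 1 + 0 := rfl
  rw [this, altBasis_apply]
  simp

theorem altDerInv_arityDer (c : 𝕜) : altDerInv 𝕜 (arityDer (Alt 𝕜).toOperad c) = 0 := by
  have : altDerInv 𝕜 (arityDer (Alt 𝕜).toOperad c) =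
    ((1 - ((2 : ℕ) : 𝕜)) * c) * (altBasis (0 : Fin 2) 1).1 0 1 + ((1 - ((0 : ℕ) : 𝕜)) * c) * 1 := rfl
  rw [this, altBasis_apply]
  simp
  ring

theorem altForm_two_ext {f g : altForm 𝕜 2} (h : f.1 0 1 = g.1 0 1) : f = g := by
  refine altForm_ext fun x y => ?_
  fin_cases x <;> fin_cases y
  · exact (f.2.1 0).trans (g.2.1 0).symm
  · exact h
  · exact (f.2.2 1 0).trans ((congrArg _ h).trans (g.2.2 1 0).symm)
  · exact (f.2.1 1).trans (g.2.1 1).symm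

theorem alt_two_eq (θ : (Alt 𝕜).obj 2) :
    θ = θ.1 • altMul 𝕜 + θ.2.1 0 1 • altBr 𝕜 := by
  refine Prod.ext ?_ (altForm_two_ext ?_)
  · change θ.1 = θ.1 * 1 + θ.2.1 0 1 * 0
    ring
  · change θ.2.1 0 1 = θ.1 * 0 + θ.2.1 0 1 * (altBasis (0 : Fin 2) 1).1 0 1
    rw [altBasis_apply]
    simp

theorem alt_one_eq (θ : (Alt 𝕜).obj 1) : θ = θ.1 • (Alt 𝕜).one :=
  Prod.ext (mul_one θ.1).symm (Subsingleton.elim (α := altForm 𝕜 1) _ _)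

theorem altMul_comp_unit0 :
    (Alt 𝕜).comp (m := 2) (n := 0) (r := 1) rfl 0 (altMul 𝕜) (Alt 𝕜).unit0 = (Alt 𝕜).one :=
  Prod.ext (mul_one (1 : 𝕜)) (Subsingleton.elim (α := altForm 𝕜 1) _ _)

theorem altBr_comp_unit0 :
    (Alt 𝕜).comp (m := 2) (n := 0) (r := 1) rfl 0 (altBr 𝕜) (Alt 𝕜).unit0 = 0 :=
  Prod.ext (zero_mul (1 : 𝕜)) (Subsingleton.elim (α := altForm 𝕜 1) _ _)

/-- By rigidity only arities below `3` matter, and these are spanned by the unit, the identity, the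
product and the bracket. The form of `d` of the product is alternating, and also symmetric because
the product is, so twice it vanishes. -/
theorem alt_der_eq_zero [NoZeroDivisors 𝕜] (h2 : (2 : 𝕜) ≠ 0) (d : (Alt 𝕜).toOperad.der)
    (h0 : d.1 0 (Alt 𝕜).unit0 = 0) (hbr : (d.1 2 (altBr 𝕜)).2.1 0 1 = 0) : d = 0 := by
  -- Inserting the unit into an operation of arity two leaves its scalar part, so `d` of the
  -- composite gives the scalar part of `d θ`.
  have hunit : ∀ θ : (Alt 𝕜).obj 2,
      d.1 1 ((Alt 𝕜).comp (m := 2) (n := 0) (r := 1) rfl 0 θ (Alt 𝕜).unit0) = 0 →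
      (d.1 2 θ).1 = 0 := by
    intro θ hθ
    have h := d.2.2 2 0 1 rfl 0 θ (Alt 𝕜).unit0
    rw [h0, map_zero] at h
    exact (mul_one _).symm.trans (congrArg Prod.fst (hθ.symm.trans (h.trans (add_zero _))).symm)
  have hmul : d.1 2 (altMul 𝕜) = 0 := by
    refine Prod.ext (hunit _ ?_) (altForm_two_ext ?_)
    · rw [altMul_comp_unit0, der_one]
    · have h := d.2.1 2 (Equiv.swap 0 1) (altMul 𝕜)
      have e : (Alt 𝕜).act (Equiv.swap 0 1) (altMul 𝕜) = altMul 𝕜 := rfl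
      rw [e] at h
      have h1 : (d.1 2 (altMul 𝕜)).2.1 0 1 = (d.1 2 (altMul 𝕜)).2.1 1 0 :=
        congrArg (fun θ : 𝕜 × altForm 𝕜 2 => θ.2.1 0 1) h
      have h3 := (d.1 2 (altMul 𝕜)).2.2.2 1 0
      have : (2 : 𝕜) * (d.1 2 (altMul 𝕜)).2.1 0 1 = 0 := by
        linear_combination h1 + h3
      exact (mul_eq_zero.mp this).resolve_left h2
  have hbr' : d.1 2 (altBr 𝕜) = 0 := by
    refine Prod.ext (hunit _ ?_) (altForm_two_ext hbr)
    rw [altBr_comp_unit0, map_zero]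
  refine der_eq_zero (Alt 𝕜) (k := 3) (by omega) alt_truncRec d fun n hn => ?_
  interval_cases n
  · ext1 θ
    obtain ⟨c, rfl⟩ := (Alt 𝕜).exists_smul_unit0 θ
    rw [map_smul, h0, smul_zero, LinearMap.zero_apply]
  · ext1 θ
    rw [alt_one_eq θ, map_smul, der_one, smul_zero, LinearMap.zero_apply]
  · ext1 θ
    rw [alt_two_eq θ, map_add, map_smul, map_smul, hmul, hbr', smul_zero, smul_zero, add_zero,
      LinearMap.zero_apply]

/-- Subtracting the arity derivation that agrees with `d` on the unit leaves a derivation to which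
`alt_der_eq_zero` applies. Conversely, operations of arity `1` are scalars, so every inner
derivation is an arity derivation. -/
theorem ker_altDerInv [NoZeroDivisors 𝕜] (h2 : (2 : 𝕜) ≠ 0) :
    LinearMap.ker (altDerInv 𝕜) = (Alt 𝕜).toOperad.innerDer := by
  ext d
  rw [LinearMap.mem_ker]
  constructor
  · intro hd
    suffices d = arityDer (Alt 𝕜).toOperad (d.1 0 (Alt 𝕜).unit0).1 by
      rw [this]
      exact arityDer_mem_innerDer _ _
    set c : 𝕜 := (d.1 0 (Alt 𝕜).unit0).1 with hc
    have e0 : (arityDer (Alt 𝕜).toOperad c).1 0 (Alt 𝕜).unit0 = d.1 0 (Alt 𝕜).unit0 := by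
      refine Prod.ext ?_ (Subsingleton.elim (α := altForm 𝕜 0) _ _)
      rw [← hc, arityDer_apply]
      change ((1 - ((0 : ℕ) : 𝕜)) * c) * 1 = c
      simp
    have hinv : altDerInv 𝕜 (d - arityDer (Alt 𝕜).toOperad c) = 0 := by
      rw [map_sub, hd, altDerInv_arityDer, sub_zero]
    have h0 : (d - arityDer (Alt 𝕜).toOperad c).1 0 (Alt 𝕜).unit0 = 0 :=
      sub_eq_zero.mpr e0.symm
    refine sub_eq_zero.mp (alt_der_eq_zero h2 _ h0 ?_)
    rw [altDerInv_apply, h0] at hinv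
    exact (add_zero _).symm.trans hinv
  · rintro ⟨a, ha⟩
    obtain ⟨c, rfl⟩ : ∃ c : 𝕜, a = c • (Alt 𝕜).one := ⟨_, alt_one_eq a⟩
    have : d = arityDer (Alt 𝕜).toOperad c :=
      Subtype.ext (funext fun n => LinearMap.ext fun θ =>
        (ha n θ).trans (inner_smul_one (Alt 𝕜).toOperad c n θ))
    rw [this, altDerInv_arityDer]

/-- The invariant is onto because it takes the value `1` on the degree derivation. -/
theorem alt_h1 [NoZeroDivisors 𝕜] (h2 : (2 : 𝕜) ≠ 0) :
    Nonempty ((Alt 𝕜).toOperad.H1 ≃ₗ[𝕜] 𝕜) := by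
  have hs : Function.Surjective (altDerInv 𝕜) := fun c => ⟨c • altDegDer 𝕜, by
    rw [map_smul, altDerInv_altDegDer, smul_eq_mul, mul_one]⟩
  exact ⟨(Submodule.quotEquivOfEq _ _ (ker_altDerInv h2).symm).trans
    ((altDerInv 𝕜).quotKerEquivOfSurjective hs)⟩

end AltCohomology

/-! ### Order of slots: a block compares with the outside as its slot did -/

section SlotOrder

variable {m n r : ℕ} (h : m + n = r + 1) (i : Fin m)

theorem outerPos_lt_outerPos {a b : Fin m} (ha : a ≠ i) (hb : b ≠ i) :
    outerPos h i a ha < outerPos h i b hb ↔ a < b := by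
  have := Fin.val_ne_of_ne ha
  have := Fin.val_ne_of_ne hb
  simp only [Fin.lt_def, outerPos_val]
  unfold shift
  split_ifs <;> omega

theorem outerPos_lt_innerPos {a : Fin m} (ha : a ≠ i) (b : Fin n) :
    outerPos h i a ha < innerPos h i b ↔ a < i := by
  have := Fin.val_ne_of_ne ha
  simp only [Fin.lt_def, outerPos_val, innerPos_val]
  unfold shift
  split_ifs <;> omega

theorem innerPos_lt_outerPos {a : Fin m} (ha : a ≠ i) (b : Fin n) :
    innerPos h i b < outerPos h i a ha ↔ i < a := by
  have := Fin.val_ne_of_ne ha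
  simp only [Fin.lt_def, outerPos_val, innerPos_val]
  unfold shift
  split_ifs <;> omega

theorem innerPos_lt_innerPos (b c : Fin n) : innerPos h i b < innerPos h i c ↔ b < c := by
  simp only [Fin.lt_def, innerPos_val]
  omega

end SlotOrder

/-! ### The operad of associative algebras: maps to `Com` and `Alt` -/

section Associative

variable {𝕜 : Type u} [CommRing 𝕜]

/-- A permutation as an operation of the operad of associative algebras. -/
noncomputable def asPerm {n : ℕ} (σ : Equiv.Perm (Fin n)) : (As 𝕜).obj n :=
  Finsupp.single σ (1 : 𝕜)

theorem as_comp_asPerm {m n r : ℕ} (h : m + n = r + 1) (i : Fin m) (φ : Equiv.Perm (Fin m))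
    (σ : Equiv.Perm (Fin n)) :
    (As 𝕜).comp h i (asPerm φ) (asPerm σ) = asPerm (permComp h i φ σ) := by
  have : (Finsupp.linearCombination 𝕜 fun φ => Finsupp.lmapDomain 𝕜 𝕜 (permComp h i φ))
      (Finsupp.single φ (1 : 𝕜)) (Finsupp.single σ (1 : 𝕜)) =
      Finsupp.single (permComp h i φ σ) (1 : 𝕜) := by
    simp
  exact this

/-- The morphism from the operad of associative algebras given by the images of the
permutations. -/
noncomputable def asLift (Q : Operad 𝕜) (g : ∀ n, Equiv.Perm (Fin n) → Q.obj n)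
    (hone : g 1 1 = Q.one) (hact : ∀ n (φ σ : Equiv.Perm (Fin n)), g n (φ * σ) = Q.act σ (g n φ))
    (hcomp : ∀ m n r (h : m + n = r + 1) (i : Fin m) (φ : Equiv.Perm (Fin m))
      (σ : Equiv.Perm (Fin n)), g r (permComp h i φ σ) = Q.comp h i (g m φ) (g n σ)) :
    OperadHom (As 𝕜).toOperad Q where
  toFun n := Finsupp.linearCombination 𝕜 (g n)
  map_one := by
    have : Finsupp.linearCombination 𝕜 (g 1) (Finsupp.single 1 1) = Q.one := by simp [hone]
    exact this
  map_act {n} σ θ := by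
    have : ∀ θ : Equiv.Perm (Fin n) →₀ 𝕜,
        Finsupp.linearCombination 𝕜 (g n) (Finsupp.lmapDomain 𝕜 𝕜 (· * σ) θ) =
          Q.act σ (Finsupp.linearCombination 𝕜 (g n) θ) := by
      intro θ
      induction θ using Finsupp.induction_linear with
      | zero => simp
      | add x y hx hy => simp only [map_add, hx, hy]
      | single φ c => simp [hact]
    exact this θ
  map_comp {m n r} h i μ ν := by
    have : ∀ (μ : Equiv.Perm (Fin m) →₀ 𝕜) (ν : Equiv.Perm (Fin n) →₀ 𝕜),
        Finsupp.linearCombination 𝕜 (g r) ((Finsupp.linearCombination 𝕜 fun φ =>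
          Finsupp.lmapDomain 𝕜 𝕜 (permComp h i φ)) μ ν) =
          Q.comp h i (Finsupp.linearCombination 𝕜 (g m) μ)
            (Finsupp.linearCombination 𝕜 (g n) ν) := by
      intro μ ν
      induction μ using Finsupp.induction_linear with
      | zero => simp
      | add x y hx hy => simp only [map_add, LinearMap.add_apply, hx, hy]
      | single φ s =>
        induction ν using Finsupp.induction_linear with
        | zero => simp
        | add x y hx hy => simp only [map_add, hx, hy]
        | single σ t => simp [hcomp, smul_smul, mul_comm, -Finsupp.single_mul]
    exact this μ ν

theorem asLift_single (Q : Operad 𝕜) (g : ∀ n, Equiv.Perm (Fin n) → Q.obj n) (hone hact hcomp)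
    {n : ℕ} (σ : Equiv.Perm (Fin n)) (c : 𝕜) :
    (asLift Q g hone hact hcomp).toFun n (Finsupp.single σ c) = c • g n σ :=
  Finsupp.linearCombination_single 𝕜 c σ

variable (𝕜)

/-- The augmentation of the operad of associative algebras. -/
noncomputable def asToCom : OperadHom (As 𝕜).toOperad (Com 𝕜).toOperad :=
  asLift _ (fun _ _ => (1 : 𝕜)) rfl (fun _ _ _ => rfl)
    (fun _ _ _ _ _ _ _ => (mul_one (1 : 𝕜)).symm)

variable {𝕜}

theorem asToCom_single {n : ℕ} (σ : Equiv.Perm (Fin n)) (c : 𝕜) :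
    (asToCom 𝕜).toFun n (Finsupp.single σ c) = c :=
  (asLift_single _ _ _ _ _ σ c).trans (mul_one c)

/-- The alternating function of the inversions of a permutation. -/
def invForm (c : 𝕜) {n : ℕ} (σ : Equiv.Perm (Fin n)) : altForm 𝕜 n :=
  ⟨fun x y => if σ x < σ y then c else if σ y < σ x then -c else 0, by
    refine ⟨fun x => by simp, fun x y => ?_⟩
    rcases lt_trichotomy (σ x) (σ y) with h | h | h
    · simp [h, h.not_gt]
    · simp [h]
    · simp [h, h.not_gt]⟩

theorem invForm_apply (c : 𝕜) {n : ℕ} (σ : Equiv.Perm (Fin n)) (x y : Fin n) :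
    (invForm c σ).1 x y = if σ x < σ y then c else if σ y < σ x then -c else 0 := rfl

/-- Two variables in the inserted block are ordered by `σ`; any other pair is ordered by `φ` after
collapsing the block. In each case the other summand is zero. -/
theorem invForm_permComp (c : 𝕜) {m n r : ℕ} (h : m + n = r + 1) (i : Fin m)
    (φ : Equiv.Perm (Fin m)) (σ : Equiv.Perm (Fin n)) (x y : Fin r) :
    (invForm c (permComp h i φ σ)).1 x y = (invForm c φ).1 (collapse h i x) (collapse h i y) +
      extendInner h i (invForm c σ).1 x y := by
  rw [invForm_apply]
  rcases pos_cases h i x with ⟨a, ha, rfl⟩ | ⟨b, rfl⟩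
  · rw [extendInner_outer_left, add_zero, collapse_outer]
    rcases pos_cases h i y with ⟨a', ha', rfl⟩ | ⟨b', rfl⟩
    · simp only [permComp_outer, outerPos_lt_outerPos, collapse_outer, invForm_apply]
    · simp only [permComp_outer, permComp_inner, outerPos_lt_innerPos, innerPos_lt_outerPos,
        collapse_inner, invForm_apply]
  · rw [collapse_inner]
    rcases pos_cases h i y with ⟨a', ha', rfl⟩ | ⟨b', rfl⟩
    · rw [extendInner_outer_right, add_zero]
      simp only [permComp_outer, permComp_inner, outerPos_lt_innerPos, innerPos_lt_outerPos,
        collapse_outer, invForm_apply]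
    · rw [collapse_inner, (invForm c φ).2.1, zero_add, extendInner_inner]
      simp only [permComp_inner, innerPos_lt_innerPos, invForm_apply]

/-- The morphism from the operad of associative algebras to the operad of alternating forms
that records the inversions. -/
noncomputable def asToAlt (c : 𝕜) : OperadHom (As 𝕜).toOperad (Alt 𝕜).toOperad :=
  asLift _ (fun n σ => ((1, invForm c σ) : 𝕜 × altForm 𝕜 n))
    (Prod.ext rfl (Subsingleton.elim (α := altForm 𝕜 1) _ _))
    (fun _ _ _ => rfl)
    (fun m n r h i φ σ => by
      refine alt_prod_ext (mul_one (1 : 𝕜)).symm fun x y => ?_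
      refine Eq.trans ?_ (altComp_snd _ _ _ _ _ _).symm
      rw [one_mul, one_mul]
      exact invForm_permComp c h i φ σ x y)

theorem asToAlt_single (c : 𝕜) {n : ℕ} (σ : Equiv.Perm (Fin n)) (a : 𝕜) :
    (asToAlt c).toFun n (Finsupp.single σ a) = ((a, a • invForm c σ) : 𝕜 × altForm 𝕜 n) :=
  (asLift_single _ _ _ _ _ σ a).trans (Prod.ext (mul_one a) rfl)

theorem as_eq_single {n : ℕ} (hn : n ≤ 1) (θ : (As 𝕜).obj n) :
    ∃ a : 𝕜, θ = Finsupp.single 1 a := by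
  have : Subsingleton (Fin n) := Fin.subsingleton_iff_le_one.mpr hn
  have key : ∀ θ : Equiv.Perm (Fin n) →₀ 𝕜, θ = Finsupp.single 1 (θ 1) := fun θ =>
    Finsupp.ext fun σ => by rw [Subsingleton.elim σ 1, Finsupp.single_eq_same]
  exact ⟨_, key θ⟩

theorem perm_two_cases (σ : Equiv.Perm (Fin 2)) : σ = 1 ∨ σ = Equiv.swap 0 1 := by
  revert σ; decide

theorem as_two_eq (θ : (As 𝕜).obj 2) :
    ∃ a b : 𝕜, θ = Finsupp.single 1 a + Finsupp.single (Equiv.swap 0 1) b := by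
  have hne : (1 : Equiv.Perm (Fin 2)) ≠ Equiv.swap 0 1 := by decide
  have key : ∀ θ : Equiv.Perm (Fin 2) →₀ 𝕜, θ = Finsupp.single 1 (θ 1) +
      Finsupp.single (Equiv.swap 0 1) (θ (Equiv.swap 0 1)) := fun θ => Finsupp.ext fun σ => by
    rw [Finsupp.add_apply]
    rcases perm_two_cases σ with rfl | rfl
    · rw [Finsupp.single_eq_same, Finsupp.single_eq_of_ne hne, add_zero]
    · rw [Finsupp.single_eq_same, Finsupp.single_eq_of_ne hne.symm, zero_add]
  exact ⟨_, _, key θ⟩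

theorem asToCom_injective {n : ℕ} (hn : n ≤ 1) : Function.Injective ((asToCom 𝕜).toFun n) := by
  intro θ θ' h
  obtain ⟨a, rfl⟩ := as_eq_single hn θ
  obtain ⟨a', rfl⟩ := as_eq_single hn θ'
  have : a = a' := (asToCom_single _ _).symm.trans (h.trans (asToCom_single _ _))
  rw [this]

theorem asToCom_surjective (n : ℕ) : Function.Surjective ((asToCom 𝕜).toFun n) :=
  fun a => ⟨Finsupp.single 1 a, asToCom_single _ _⟩

theorem asToAlt_two (c a b : 𝕜) :
    (asToAlt c).toFun 2 (Finsupp.single 1 a + Finsupp.single (Equiv.swap 0 1) b) =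
      ((a + b, a • invForm c 1 + b • invForm c (Equiv.swap 0 1)) : 𝕜 × altForm 𝕜 2) := by
  refine (map_add _ _ _).trans ?_
  rw [asToAlt_single, asToAlt_single]
  rfl

theorem asToAlt_two_form (c a b : 𝕜) :
    (a • invForm c (1 : Equiv.Perm (Fin 2)) + b • invForm c (Equiv.swap 0 1)).1 0 1 =
      c * (a - b) := by
  change a * (invForm c (1 : Equiv.Perm (Fin 2))).1 0 1 +
    b * (invForm c (Equiv.swap (0 : Fin 2) 1)).1 0 1 = _
  rw [invForm_apply, invForm_apply]
  simp
  ring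

/-- In arity two the map is `(a, b) ↦ (a + b, c(a - b))`, of determinant `-2c = -1`. -/
theorem asToAlt_injective {c : 𝕜} (hc : 2 * c = 1) {n : ℕ} (hn : n < 3) :
    Function.Injective ((asToAlt c).toFun n) := by
  intro θ θ' h
  rcases Nat.lt_or_ge n 2 with hn' | hn'
  · obtain ⟨a, rfl⟩ := as_eq_single (by omega) θ
    obtain ⟨a', rfl⟩ := as_eq_single (by omega) θ'
    have : a = a' :=
      congrArg Prod.fst ((asToAlt_single _ _ _).symm.trans (h.trans (asToAlt_single _ _ _)))
    rw [this]
  · obtain rfl : n = 2 := by omega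
    obtain ⟨a, b, rfl⟩ := as_two_eq θ
    obtain ⟨a', b', rfl⟩ := as_two_eq θ'
    have h := (asToAlt_two _ _ _).symm.trans (h.trans (asToAlt_two _ _ _))
    have h1 : a + b = a' + b' := congrArg Prod.fst h
    have h3 : c * (a - b) = c * (a' - b') := by
      have := congrArg (fun f => f.2.1 0 1) h
      dsimp only at this
      rwa [asToAlt_two_form, asToAlt_two_form] at this
    have ha : a = a' := by
      linear_combination c * h1 + h3 + (a' - a) * hc
    have hb : b = b' := by
      linear_combination h1 - ha
    rw [ha, hb]

theorem asToAlt_two_surjective {c : 𝕜} (hc : 2 * c = 1) :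
    Function.Surjective ((asToAlt c).toFun 2) := by
  intro θ
  -- The solution of `a + b = s`, `c(a - b) = t`, namely `a = cs + t` and `b = cs - t`.
  refine ⟨Finsupp.single 1 (c * θ.1 + θ.2.1 0 1) +
    Finsupp.single (Equiv.swap 0 1) (c * θ.1 - θ.2.1 0 1), (asToAlt_two _ _ _).trans ?_⟩
  refine Prod.ext ?_ (altForm_two_ext ?_)
  · change c * θ.1 + θ.2.1 0 1 + (c * θ.1 - θ.2.1 0 1) = (θ.1 : 𝕜)
    linear_combination (θ.1 : 𝕜) * hc
  · refine (asToAlt_two_form _ _ _).trans ?_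
    linear_combination (θ.2.1 0 1 : 𝕜) * hc

end Associative

/-! ### A suboperad prescribed in arities at most two -/

section LowSpan

variable {𝕜 : Type u} [CommRing 𝕜]

/-- The operations whose full substitutions of `e` down to arity two lie in `A`; in arities zero
and one these are the multiples of `e` and of the identity. -/
def lowSpan (P : Operad 𝕜) (e : P.obj 0) (A : Submodule 𝕜 (P.obj 2)) :
    ∀ n, Submodule 𝕜 (P.obj n)
  | 0 => Submodule.span 𝕜 {e}
  | 1 => Submodule.span 𝕜 {P.one}
  | 2 => A
  | n + 3 => ⨅ i : Fin (n + 3), (lowSpan P e A (n + 2)).comap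
      ((P.comp (m := n + 3) (n := 0) (r := n + 2) rfl i).flip e)

variable (P : Operad 𝕜) (e : P.obj 0) (A : Submodule 𝕜 (P.obj 2))

theorem mem_lowSpan {m n : ℕ} (h : m + 0 = n + 1) (hn : 2 ≤ n) (θ : P.obj m) :
    θ ∈ lowSpan P e A m ↔ ∀ i, P.comp h i θ e ∈ lowSpan P e A n := by
  obtain ⟨n, rfl⟩ : ∃ n', n = n' + 2 := ⟨n - 2, by omega⟩
  obtain rfl : m = n + 3 := h
  simp [lowSpan]

variable {P e A}

theorem lowSpan_comp_unit
    (hA : ∀ θ ∈ A, ∀ i, P.comp (m := 2) (n := 0) (r := 1) rfl i θ e ∈ Submodule.span 𝕜 {P.one})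
    {m n : ℕ} (h : m + 0 = n + 1) (i : Fin m) (θ : P.obj m)
    (hθ : θ ∈ lowSpan P e A m) : P.comp h i θ e ∈ lowSpan P e A n := by
  by_cases hn : 2 ≤ n
  · exact (mem_lowSpan P e A h hn θ).mp hθ i
  obtain rfl : m = n + 1 := h
  interval_cases n
  · obtain ⟨c, rfl⟩ := Submodule.mem_span_singleton.mp hθ
    obtain rfl : i = 0 := Subsingleton.elim (α := Fin 1) _ _
    rw [map_smul, LinearMap.smul_apply, P.one_comp]
    exact Submodule.smul_mem _ _ (Submodule.mem_span_singleton_self e)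
  · exact hA θ hθ i

theorem lowSpan_act (hA : ∀ θ ∈ A, ∀ σ, P.act σ θ ∈ A) {n : ℕ} (σ : Equiv.Perm (Fin n))
    (θ : P.obj n) (hθ : θ ∈ lowSpan P e A n) : P.act σ θ ∈ lowSpan P e A n := by
  induction n with
  | zero => rwa [Subsingleton.elim σ 1, P.act_one]
  | succ n ih =>
    by_cases hn : 2 ≤ n
    · rw [mem_lowSpan P e A rfl hn] at *
      intro i
      rw [P.act_comp]
      exact ih _ _ (hθ _)
    · interval_cases n
      · rwa [Subsingleton.elim (α := Equiv.Perm (Fin 1)) σ 1, P.act_one]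
      · exact hA _ hθ _

theorem lowSpan_comp
    (hA : ∀ θ ∈ A, ∀ i, P.comp (m := 2) (n := 0) (r := 1) rfl i θ e ∈ Submodule.span 𝕜 {P.one}) :
    ∀ {r m n : ℕ} (h : m + n = r + 1) (i : Fin m) (μ : P.obj m) (ν : P.obj n),
    μ ∈ lowSpan P e A m → ν ∈ lowSpan P e A n → P.comp h i μ ν ∈ lowSpan P e A r := by
  have base : ∀ {r m : ℕ} (h : m + 0 = r + 1) (i : Fin m) (μ : P.obj m) (ν : P.obj 0),
      μ ∈ lowSpan P e A m → ν ∈ lowSpan P e A 0 → P.comp h i μ ν ∈ lowSpan P e A r := by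
    intro r m h i μ ν hμ hν
    obtain ⟨c, rfl⟩ := Submodule.mem_span_singleton.mp hν
    rw [map_smul]
    exact Submodule.smul_mem _ _ (lowSpan_comp_unit hA h i μ hμ)
  have left : ∀ {r n : ℕ} (h : 1 + n = r + 1) (i : Fin 1) (μ : P.obj 1) (ν : P.obj n),
      μ ∈ lowSpan P e A 1 → ν ∈ lowSpan P e A n → P.comp h i μ ν ∈ lowSpan P e A r := by
    intro r n h i μ ν hμ hν
    obtain rfl : n = r := by omega
    obtain rfl : i = 0 := Subsingleton.elim _ _
    obtain ⟨c, rfl⟩ := Submodule.mem_span_singleton.mp hμ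
    rw [map_smul, LinearMap.smul_apply, P.one_comp]
    exact Submodule.smul_mem _ _ hν
  have right : ∀ {r m : ℕ} (h : m + 1 = r + 1) (i : Fin m) (μ : P.obj m) (ν : P.obj 1),
      μ ∈ lowSpan P e A m → ν ∈ lowSpan P e A 1 → P.comp h i μ ν ∈ lowSpan P e A r := by
    intro r m h i μ ν hμ hν
    obtain rfl : m = r := by omega
    obtain ⟨c, rfl⟩ := Submodule.mem_span_singleton.mp hν
    rw [map_smul, P.comp_one]
    exact Submodule.smul_mem _ _ hμ
  intro r
  induction r with
  | zero =>
    intro m n h i μ ν hμ hν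
    obtain rfl : n = 0 := by have := i.2; omega
    exact base h i μ ν hμ hν
  | succ r ih =>
    intro m n h i μ ν hμ hν
    have hi := i.2
    rcases Nat.eq_zero_or_pos n with rfl | hn
    · exact base h i μ ν hμ hν
    by_cases hn1 : n = 1
    · subst hn1
      exact right h i μ ν hμ hν
    by_cases hm1 : m = 1
    · subst hm1
      exact left h i μ ν hμ hν
    -- Now both factors have arity at least two and the composite at least three, so membership is
    -- tested by inserting `e`. The operad axioms push `e` into `μ` or `ν`, which lowers the arity.
    rw [mem_lowSpan P e A (n := r) rfl (by omega)]
    intro x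
    rcases pos_cases h i x with ⟨a, ha, rfl⟩ | ⟨b, rfl⟩
    · rcases lt_or_gt_of_ne ha with hlt | hlt
      · have hlt' : a.1 < i.1 := hlt
        have := P.comp_comm (l := m) (m := 0) (n := n) (p := m - 1) (q := r + 1) (r := r)
          (by omega) (by omega) h rfl a i hlt μ e ν
        have e' : outerPos h i a ha = ⟨a, by omega⟩ := by
          ext; simp [outerPos_val, shift, hlt']
        rw [e', ← this]
        exact ih _ _ _ _ (lowSpan_comp_unit hA _ _ _ hμ) hν
      · have hlt' : i.1 < a.1 := hlt
        have := P.comp_comm (l := m) (m := n) (n := 0) (p := r + 1) (q := m - 1) (r := r)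
          h rfl (by omega) (by omega) i a hlt μ ν e
        have e' : outerPos h i a ha = ⟨a + n - 1, by omega⟩ := by
          ext; simp [outerPos_val, shift, not_lt.mpr hlt'.le]
        rw [e', this]
        exact ih _ _ _ _ (lowSpan_comp_unit hA _ _ _ hμ) hν
    · have := P.comp_assoc (l := m) (m := n) (n := 0) (p := r + 1) (q := n - 1) (r := r)
        h rfl (by omega) (by omega) i b μ ν e
      have e' : innerPos h i b = ⟨i + b, by omega⟩ := rfl
      rw [e', this]
      exact ih _ _ _ _ hμ (lowSpan_comp_unit hA _ _ _ hν)

end LowSpan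

/-! ### The operad of Poisson algebras in low arity: maps to `Alt` and `Com` -/

section Poisson

variable (𝕜 : Type u) [CommRing 𝕜]

/-- The product of the operad of Poisson algebras. -/
def poisMul : (Pois 𝕜).obj 2 := presentedMk (PoisRel 𝕜) (mulT 𝕜)

/-- The bracket of the operad of Poisson algebras. -/
def poisBr : (Pois 𝕜).obj 2 := presentedMk (PoisRel 𝕜) (brT 𝕜)

theorem poisMul_comp_unit0 (i : Fin 2) :
    (Pois 𝕜).comp (m := 2) (n := 0) (r := 1) rfl i (poisMul 𝕜) (Pois 𝕜).unit0 = (Pois 𝕜).one :=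
  Quotient.sound (.of (.mul_unit i))

theorem poisBr_comp_unit0 (i : Fin 2) :
    (Pois 𝕜).comp (m := 2) (n := 0) (r := 1) rfl i (poisBr 𝕜) (Pois 𝕜).unit0 = 0 :=
  Quotient.sound (.of (.br_unit i))

theorem poisMul_swap : (Pois 𝕜).act (Equiv.swap 0 1) (poisMul 𝕜) = poisMul 𝕜 :=
  Quotient.sound (.of .mul_comm)

theorem poisBr_swap : (Pois 𝕜).act (Equiv.swap 0 1) (poisBr 𝕜) = (-1 : 𝕜) • poisBr 𝕜 :=
  Quotient.sound (.of .br_skew)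

theorem poisMul_assoc :
    (Pois 𝕜).comp (m := 2) (n := 2) (r := 3) rfl 0 (poisMul 𝕜) (poisMul 𝕜) =
      (Pois 𝕜).comp (m := 2) (n := 2) (r := 3) rfl 1 (poisMul 𝕜) (poisMul 𝕜) :=
  Quotient.sound (.of .mul_assoc)

variable {𝕜}

/-- `lowSpan` is closed under the operad operations and contains the generators, hence is all of
`Pois`. Read in arities `1` and `2`, this bounds `Pois` from above without a normal form for its
elements. -/
theorem pois_mem_lowSpan {n : ℕ} (θ : (Pois 𝕜).obj n) :
    θ ∈ lowSpan (Pois 𝕜).toOperad (Pois 𝕜).unit0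
      (Submodule.span 𝕜 {poisMul 𝕜, poisBr 𝕜}) n := by
  have hact : ∀ θ ∈ Submodule.span 𝕜 {poisMul 𝕜, poisBr 𝕜}, ∀ σ,
      (Pois 𝕜).act σ θ ∈ Submodule.span 𝕜 {poisMul 𝕜, poisBr 𝕜} := by
    intro θ hθ σ
    rcases perm_two_cases σ with rfl | rfl
    · rwa [(Pois 𝕜).act_one]
    · obtain ⟨a, b, rfl⟩ := Submodule.mem_span_pair.mp hθ
      rw [map_add, map_smul, map_smul, poisMul_swap, poisBr_swap]
      exact Submodule.mem_span_pair.mpr ⟨a, b * (-1), by rw [mul_smul]⟩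
  have hunit : ∀ θ ∈ Submodule.span 𝕜 {poisMul 𝕜, poisBr 𝕜}, ∀ i,
      (Pois 𝕜).comp (m := 2) (n := 0) (r := 1) rfl i θ (Pois 𝕜).unit0 ∈
        Submodule.span 𝕜 {(Pois 𝕜).one} := by
    intro θ hθ i
    obtain ⟨a, b, rfl⟩ := Submodule.mem_span_pair.mp hθ
    rw [map_add, map_smul, map_smul, LinearMap.add_apply, LinearMap.smul_apply,
      LinearMap.smul_apply, poisMul_comp_unit0, poisBr_comp_unit0, smul_zero, add_zero]
    exact Submodule.smul_mem _ _ (Submodule.mem_span_singleton_self _)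
  suffices ∀ {n : ℕ} (t : OpTerm 𝕜 PoisGen n), presentedMk (PoisRel 𝕜) t ∈
      lowSpan (Pois 𝕜).toOperad (Pois 𝕜).unit0 (Submodule.span 𝕜 {poisMul 𝕜, poisBr 𝕜}) n by
    obtain ⟨t⟩ := θ
    exact this t
  intro n t
  induction t with
  | gen g =>
    cases g with
    | unit => exact Submodule.mem_span_singleton_self (Pois 𝕜).unit0
    | mul => exact Submodule.subset_span (Set.mem_insert (poisMul 𝕜) _)
    | br => exact Submodule.subset_span (Set.mem_insert_of_mem _ (Set.mem_singleton (poisBr 𝕜)))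
  | one => exact Submodule.mem_span_singleton_self (Pois 𝕜).one
  | zero n => exact zero_mem _
  | add a b iha ihb => exact add_mem iha ihb
  | smul c a ih => exact Submodule.smul_mem _ c ih
  | act σ a ih => exact lowSpan_act hact σ _ ih
  | comp h i a b iha ihb => exact lowSpan_comp hunit h i _ _ iha ihb

theorem pois_one_eq (θ : (Pois 𝕜).obj 1) : ∃ c : 𝕜, θ = c • (Pois 𝕜).one :=
  let ⟨c, hc⟩ := Submodule.mem_span_singleton.mp (pois_mem_lowSpan θ)
  ⟨c, hc.symm⟩

theorem pois_two_eq (θ : (Pois 𝕜).obj 2) : ∃ a b : 𝕜, θ = a • poisMul 𝕜 + b • poisBr 𝕜 :=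
  let ⟨a, b, hab⟩ := Submodule.mem_span_pair.mp (pois_mem_lowSpan θ)
  ⟨a, b, hab.symm⟩

variable (𝕜)

/-- The morphism from the operad of Poisson algebras to the operad of alternating forms. -/
def poisToAlt : OperadHom (Pois 𝕜).toOperad (Alt 𝕜).toOperad :=
  presentedLift (Alt 𝕜).toOperad
    (fun _ g => match g with
      | .unit => (Alt 𝕜).unit0
      | .mul => altMul 𝕜
      | .br => altBr 𝕜)
    (by
      intro n a b h
      cases h with
      | mul_unit i =>
        exact Prod.ext (mul_one (1 : 𝕜)) (Subsingleton.elim (α := altForm 𝕜 1) _ _)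
      | br_unit i =>
        exact Prod.ext (zero_mul (1 : 𝕜)) (Subsingleton.elim (α := altForm 𝕜 1) _ _)
      | mul_comm => rfl
      | br_skew =>
        refine alt_prod_ext (mul_zero (-1 : 𝕜)).symm fun x y => ?_
        change (altBasis (0 : Fin 2) 1).1 (Equiv.swap 0 1 x) (Equiv.swap 0 1 y) =
          -1 * (altBasis (0 : Fin 2) 1).1 x y
        fin_cases x <;> fin_cases y <;> simp [altBasis_apply]
      | mul_assoc =>
        have : altComp 𝕜 (m := 2) (n := 2) (r := 3) rfl 0 (1, 0) (1, 0) =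
            altComp 𝕜 (m := 2) (n := 2) (r := 3) rfl 1 (1, 0) (1, 0) := by
          simp [altComp_apply]
        exact this
      | leibniz =>
        refine alt_prod_ext (by
          change (0 : 𝕜) * 1 = 1 * 0 + 1 * 0
          simp) fun x y => ?_
        -- The form of `[xy, z]` pairs the third slot with each of the first two. On the right the
        -- first term accounts for the slots `1, 2` and its transpose for `0, 2`.
        have e : ∀ x y, (altComp 𝕜 (m := 2) (n := 2) (r := 3) rfl 0 (0, altBasis 0 1) (1, 0)).2.1 x y =
            (altComp 𝕜 (m := 2) (n := 2) (r := 3) rfl 1 (1, 0) (0, altBasis 0 1)).2.1 x y +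
            (altComp 𝕜 (m := 2) (n := 2) (r := 3) rfl 1 (1, 0) (0, altBasis 0 1)).2.1
              (Equiv.swap 0 1 x) (Equiv.swap 0 1 y) := by
          intro x y
          have s2 : Equiv.swap (0 : Fin 3) 1 2 = 2 := by decide
          rw [altComp_snd, altComp_snd, altComp_snd]
          fin_cases x <;> fin_cases y <;>
            simp [altBasis_apply, extendInner, collapse, s2]
        exact e x y
      | jacobi =>
        -- Every iterated bracket is a product of two forms, so all three terms are zero.
        have : altComp 𝕜 (m := 2) (n := 2) (r := 3) rfl 1 (0, altBasis 0 1) (0, altBasis 0 1) =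
            altComp 𝕜 (m := 2) (n := 2) (r := 3) rfl 0 (0, altBasis 0 1) (0, altBasis 0 1) +
            LinearMap.prodMap LinearMap.id (altPull (Equiv.swap 0 1))
              (altComp 𝕜 (m := 2) (n := 2) (r := 3) rfl 1 (0, altBasis 0 1) (0, altBasis 0 1)) := by
          simp [altComp_apply]
        exact this)

variable {𝕜}

theorem poisToAlt_two (a b : 𝕜) :
    (poisToAlt 𝕜).toFun 2 (a • poisMul 𝕜 + b • poisBr 𝕜) = a • altMul 𝕜 + b • altBr 𝕜 := by
  rw [map_add, map_smul, map_smul]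
  rfl

theorem alt_two_coeff (a b : 𝕜) :
    (a • altMul 𝕜 + b • altBr 𝕜).1 = a ∧ (a • altMul 𝕜 + b • altBr 𝕜).2.1 0 1 = b := by
  constructor
  · change a * 1 + b * 0 = a
    ring
  · change a * 0 + b * (altBasis (0 : Fin 2) 1).1 0 1 = b
    rw [altBasis_apply]
    simp

theorem hom_zero_injective {P Q : UnitaryOperad 𝕜} (F : OperadHom P.toOperad Q.toOperad)
    (h0 : F.toFun 0 P.unit0 = Q.unit0) : Function.Injective (F.toFun 0) := by
  intro θ θ' h
  obtain ⟨a, rfl⟩ := P.exists_smul_unit0 θ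
  obtain ⟨b, rfl⟩ := P.exists_smul_unit0 θ'
  rw [map_smul, map_smul, h0] at h
  rw [Q.unit0_basis.1 h]

/-- The spanning sets found through `lowSpan` have linearly independent images. -/
theorem poisToAlt_injective {n : ℕ} (hn : n < 3) : Function.Injective ((poisToAlt 𝕜).toFun n) := by
  interval_cases n
  · exact hom_zero_injective (P := Pois 𝕜) (Q := Alt 𝕜) (poisToAlt 𝕜) rfl
  · intro θ θ' h
    obtain ⟨a, rfl⟩ := pois_one_eq θ
    obtain ⟨b, rfl⟩ := pois_one_eq θ'
    rw [map_smul, map_smul, (poisToAlt 𝕜).map_one] at h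
    have : a = b := (mul_one a).symm.trans ((congrArg Prod.fst h).trans (mul_one b))
    rw [this]
  · intro θ θ' h
    obtain ⟨a, b, rfl⟩ := pois_two_eq θ
    obtain ⟨a', b', rfl⟩ := pois_two_eq θ'
    rw [poisToAlt_two, poisToAlt_two] at h
    obtain ⟨h1, h2⟩ := alt_two_coeff a b
    obtain ⟨h3, h4⟩ := alt_two_coeff a' b'
    rw [h] at h1 h2
    rw [← h1, ← h2, h3, h4]

theorem poisToAlt_two_surjective : Function.Surjective ((poisToAlt 𝕜).toFun 2) := fun θ =>
  ⟨θ.1 • poisMul 𝕜 + θ.2.1 0 1 • poisBr 𝕜, (poisToAlt_two _ _).trans (alt_two_eq θ).symm⟩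

theorem poisToCom_injective {n : ℕ} (hn : n ≤ 1) :
    Function.Injective ((poisToCom (𝕜 := 𝕜)).toFun n) := by
  interval_cases n
  · exact hom_zero_injective (P := Pois 𝕜) (Q := Com 𝕜) poisToCom rfl
  · intro θ θ' h
    obtain ⟨a, rfl⟩ := pois_one_eq θ
    obtain ⟨b, rfl⟩ := pois_one_eq θ'
    have : a = b := (mul_one a).symm.trans (h.trans (mul_one b))
    rw [this]

/-- A preimage of `1` in arity two, composed repeatedly starting from the unit, gives a preimage of
`1` in each arity. -/
theorem com_surjective {P : UnitaryOperad 𝕜} (F : OperadHom P.toOperad (Com 𝕜).toOperad)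
    (h0 : F.toFun 0 P.unit0 = (Com 𝕜).unit0) (h2 : Function.Surjective (F.toFun 2)) (n : ℕ) :
    Function.Surjective (F.toFun n) := by
  have key : ∃ θ : P.obj n, F.toFun n θ = (1 : 𝕜) := by
    induction n with
    | zero => exact ⟨_, h0⟩
    | succ n ih =>
      obtain ⟨θ, hθ⟩ := ih
      obtain ⟨μ, hμ⟩ := h2 (1 : 𝕜)
      have h : 2 + n = n + 1 + 1 := by omega
      refine ⟨P.comp h 0 μ θ, ?_⟩
      rw [F.map_comp, hμ, hθ]
      exact mul_one (1 : 𝕜)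
  obtain ⟨θ, hθ⟩ := key
  have (a : 𝕜) : F.toFun n (a • θ) = a := by
    rw [map_smul, hθ]
    exact mul_one a
  exact fun a => ⟨_, this a⟩

theorem poisToCom_surjective (n : ℕ) : Function.Surjective ((poisToCom (𝕜 := 𝕜)).toFun n) := by
  have (a : 𝕜) : poisToCom.toFun 2 (a • poisMul 𝕜) = a := mul_one a
  exact com_surjective (P := Pois 𝕜) poisToCom rfl (fun a => ⟨_, this a⟩) n

end Poisson

/-! ### Obstructions to an isomorphism: commutative products in `As` -/

section Obstruction

variable {𝕜 : Type u}

/-- The ideal is zero below arity `k`, so identities of the quotient hold there in `P` itself. -/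
theorem UnitaryOperad.modTrunc_mk_inj [CommRing 𝕜] {P : UnitaryOperad 𝕜} {k n : ℕ} (hn : n < k)
    {θ θ' : P.obj n} :
    (Submodule.Quotient.mk θ : (P.modTrunc k).obj n) = Submodule.Quotient.mk θ' ↔ θ = θ' := by
  refine (Submodule.Quotient.eq _).trans ?_
  change θ - θ' ∈ P.truncSubmodule k n ↔ _
  rw [truncSubmodule, if_pos hn, Submodule.mem_bot, sub_eq_zero]

/-- If the `k`-th truncations of `As` and `Pois` are isomorphic, with `k ≥ 3`, then `As` has a
commutative operation of arity two with a unit, which is associative if `k ≥ 4`. -/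
theorem exists_as_product [CommRing 𝕜] {k : ℕ} (hk : 3 ≤ k)
    (h : OperadIso ((As 𝕜).modTrunc k) ((Pois 𝕜).modTrunc k)) :
    ∃ (x : (As 𝕜).obj 2) (u : (As 𝕜).obj 0),
      (As 𝕜).comp (m := 2) (n := 0) (r := 1) rfl 0 x u = (As 𝕜).one ∧
      (As 𝕜).act (Equiv.swap 0 1) x = x ∧
      (4 ≤ k → (As 𝕜).comp (m := 2) (n := 2) (r := 3) rfl 0 x x =
        (As 𝕜).comp (m := 2) (n := 2) (r := 3) rfl 1 x x) := by
  -- Only a morphism from the truncation of `Pois` to that of `As` is used. The images of product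
  -- and unit are lifted to `As`; the relations live in arities `1`, `2` and `3`, and the last is
  -- below `k` only for `k ≥ 4`.
  obtain ⟨f, -⟩ := h.symm
  let mk : ∀ n, (Pois 𝕜).obj n → ((Pois 𝕜).modTrunc k).obj n := fun n => Submodule.Quotient.mk
  obtain ⟨x, hx⟩ := Submodule.Quotient.mk_surjective _ (f.toFun 2 (mk 2 (poisMul 𝕜)))
  obtain ⟨u, hu⟩ := Submodule.Quotient.mk_surjective _ (f.toFun 0 (mk 0 (Pois 𝕜).unit0))
  refine ⟨x, u, ?_, ?_, fun hk' => ?_⟩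
  · rw [← UnitaryOperad.modTrunc_mk_inj (by omega : 1 < k)]
    change ((As 𝕜).modTrunc k).comp (m := 2) (n := 0) (r := 1) rfl 0 (Submodule.Quotient.mk x)
      (Submodule.Quotient.mk u) = ((As 𝕜).modTrunc k).one
    rw [hx, hu, ← f.map_comp, ← f.map_one]
    exact congrArg (fun θ => f.toFun 1 (mk 1 θ)) (poisMul_comp_unit0 𝕜 0)
  · rw [← UnitaryOperad.modTrunc_mk_inj (by omega : 2 < k)]
    change ((As 𝕜).modTrunc k).act (Equiv.swap 0 1) (Submodule.Quotient.mk x) =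
      Submodule.Quotient.mk x
    rw [hx, ← f.map_act]
    exact congrArg (fun θ => f.toFun 2 (mk 2 θ)) (poisMul_swap 𝕜)
  · rw [← UnitaryOperad.modTrunc_mk_inj (by omega : 3 < k)]
    change ((As 𝕜).modTrunc k).comp (m := 2) (n := 2) (r := 3) rfl 0 (Submodule.Quotient.mk x)
      (Submodule.Quotient.mk x) = ((As 𝕜).modTrunc k).comp (m := 2) (n := 2) (r := 3) rfl 1
        (Submodule.Quotient.mk x) (Submodule.Quotient.mk x)
    rw [hx, ← f.map_comp, ← f.map_comp]
    exact congrArg (fun θ => f.toFun 3 (mk 3 θ)) (poisMul_assoc 𝕜)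

/-- The anticommutator. -/
noncomputable def asAnti (𝕜 : Type u) [CommRing 𝕜] : (As 𝕜).obj 2 :=
  asPerm 1 + asPerm (Equiv.swap 0 1)

/-- A commutative operation in `As` of arity two is a multiple of the anticommutator. -/
theorem as_two_comm [CommRing 𝕜] (x : (As 𝕜).obj 2)
    (hx : (As 𝕜).act (Equiv.swap 0 1) x = x) : ∃ a : 𝕜, x = a • asAnti 𝕜 := by
  obtain ⟨a, b, rfl⟩ := as_two_eq x
  have hne : (1 : Equiv.Perm (Fin 2)) ≠ Equiv.swap 0 1 := by decide
  have h : Finsupp.lmapDomain 𝕜 𝕜 (· * Equiv.swap (0 : Fin 2) 1)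
      (Finsupp.single 1 a + Finsupp.single (Equiv.swap 0 1) b) =
      (Finsupp.single 1 a + Finsupp.single (Equiv.swap 0 1) b) := hx
  -- The transposition exchanges the two coefficients, so comparing at the identity shows that they
  -- agree.
  have h' := DFunLike.congr_fun h 1
  simp only [map_add, Finsupp.lmapDomain_apply, Finsupp.mapDomain_single, one_mul,
    Equiv.swap_mul_self, Finsupp.add_apply, Finsupp.single_eq_same,
    Finsupp.single_eq_of_ne hne, zero_add, add_zero] at h'
  subst h'
  refine ⟨b, ?_⟩
  have : (Finsupp.single 1 b + Finsupp.single (Equiv.swap 0 1) b : Equiv.Perm (Fin 2) →₀ 𝕜) =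
      b • (Finsupp.single 1 1 + Finsupp.single (Equiv.swap 0 1) 1) := by
    simp [-Finsupp.single_add]
  exact this

/-- The augmentation to `Com` sends the anticommutator to `2`; `c` is the augmentation of `u`. -/
theorem as_two_unital [CommRing 𝕜] (a : 𝕜) (u : (As 𝕜).obj 0)
    (h : (As 𝕜).comp (m := 2) (n := 0) (r := 1) rfl 0 (a • asAnti 𝕜) u = (As 𝕜).one) :
    ∃ c : 𝕜, 2 * a * c = 1 := by
  have h' := congrArg ((asToCom 𝕜).toFun 1) h
  rw [(asToCom 𝕜).map_comp, (asToCom 𝕜).map_one, map_smul, asAnti, map_add, asPerm, asPerm,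
    asToCom_single, asToCom_single] at h'
  obtain ⟨c, hc⟩ : ∃ c : 𝕜, c = (asToCom 𝕜).toFun 0 u := ⟨_, rfl⟩
  rw [← hc] at h'
  have : a * (1 + 1) * c = 1 := h'
  exact ⟨c, by linear_combination this⟩

/-- The sum of the coefficients of the words of three letters with the first variable in the
middle. -/
noncomputable def middleCoeff [CommRing 𝕜] : (As 𝕜).obj 3 →ₗ[𝕜] 𝕜 :=
  Finsupp.linearCombination 𝕜 fun σ : Equiv.Perm (Fin 3) => if (σ 0).1 = 1 then (1 : 𝕜) else 0

theorem middleCoeff_asPerm [CommRing 𝕜] (σ : Equiv.Perm (Fin 3)) :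
    middleCoeff (asPerm (𝕜 := 𝕜) σ) = if (σ 0).1 = 1 then 1 else 0 :=
  (Finsupp.linearCombination_single 𝕜 _ _).trans (one_smul 𝕜 _)

/-- The first variable lies in the inserted block, which starts at `φ 0`, at offset `σ 0`. -/
theorem middleCoeff_comp_zero [CommRing 𝕜] (φ σ : Equiv.Perm (Fin 2)) :
    middleCoeff ((As 𝕜).comp (m := 2) (n := 2) (r := 3) rfl 0 (asPerm φ) (asPerm σ)) =
      if (φ 0).1 + (σ 0).1 = 1 then 1 else 0 := by
  have := permComp_inner' (m := 2) (n := 2) (r := 3) rfl φ σ (i := 0) (x := 0) 0 rfl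
  rw [as_comp_asPerm, middleCoeff_asPerm, this]

/-- The other two variables form a block of adjacent letters, so the first variable is at one end of
the word. -/
theorem middleCoeff_comp_one [CommRing 𝕜] (φ σ : Equiv.Perm (Fin 2)) :
    middleCoeff ((As 𝕜).comp (m := 2) (n := 2) (r := 3) rfl 1 (asPerm φ) (asPerm σ)) = 0 := by
  have := permComp_outer' (m := 2) (n := 2) (r := 3) rfl φ σ (i := 1) (x := 0) 0 (by decide) rfl
  rw [as_comp_asPerm, middleCoeff_asPerm, this, if_neg]
  have := Fin.val_ne_of_ne (φ.injective.ne (by decide : (0 : Fin 2) ≠ 1))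
  unfold shift
  split_ifs <;> omega

/-- The anticommutator is not associative. -/
theorem as_anticommutator_assoc [CommRing 𝕜] (a : 𝕜)
    (h : (As 𝕜).comp (m := 2) (n := 2) (r := 3) rfl 0 (a • asAnti 𝕜) (a • asAnti 𝕜) =
      (As 𝕜).comp (m := 2) (n := 2) (r := 3) rfl 1 (a • asAnti 𝕜) (a • asAnti 𝕜)) :
    2 * a * a = 0 := by
  have h' := congrArg middleCoeff h
  simp only [asAnti, map_smul, map_add, LinearMap.smul_apply, LinearMap.add_apply,
    middleCoeff_comp_zero, middleCoeff_comp_one, Equiv.Perm.one_apply, Equiv.swap_apply_left,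
    Fin.val_zero, Fin.val_one, smul_eq_mul, add_zero, mul_zero] at h'
  -- Of the four words on the left, two have the first variable in the middle; on the right none
  -- has.
  norm_num at h'
  linear_combination h'

end Obstruction

end Operadic

/-! ### Assembly of the theorem -/

theorem theorem3p8 (𝕜 : Type u) [Field 𝕜] :
    -- the first and second truncations are all isomorphic to `Com`, and their `H¹` vanishes
    ((OperadIso ((As 𝕜).modTrunc 1) ((Pois 𝕜).modTrunc 1) ∧
        OperadIso ((Pois 𝕜).modTrunc 1) ((As 𝕜).modTrunc 2) ∧
        OperadIso ((As 𝕜).modTrunc 2) ((Pois 𝕜).modTrunc 2) ∧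
        OperadIso ((Pois 𝕜).modTrunc 2) (Com 𝕜).toOperad) ∧
      Subsingleton ((As 𝕜).modTrunc 1).H1 ∧ Subsingleton ((Pois 𝕜).modTrunc 1).H1 ∧
      Subsingleton ((As 𝕜).modTrunc 2).H1 ∧ Subsingleton ((Pois 𝕜).modTrunc 2).H1 ∧
      Subsingleton (Com 𝕜).toOperad.H1) ∧
    -- the third truncations in characteristic different from `2`
    (ringChar 𝕜 ≠ 2 →
      OperadIso ((As 𝕜).modTrunc 3) ((Pois 𝕜).modTrunc 3) ∧
      Nonempty (((As 𝕜).modTrunc 3).H1 ≃ₗ[𝕜] 𝕜) ∧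
      Nonempty (((Pois 𝕜).modTrunc 3).H1 ≃ₗ[𝕜] 𝕜)) ∧
    -- the third truncations in characteristic `2`
    (ringChar 𝕜 = 2 → ¬ OperadIso ((As 𝕜).modTrunc 3) ((Pois 𝕜).modTrunc 3)) ∧
    -- the higher truncations
    (∀ k : ℕ, 4 ≤ k → ¬ OperadIso ((As 𝕜).modTrunc k) ((Pois 𝕜).modTrunc k)) := by
  have as_com : ∀ k, 0 < k → k ≤ 2 → OperadIso ((As 𝕜).modTrunc k) (Com 𝕜).toOperad :=
    fun k hk hk' => UnitaryOperad.modTrunc_iso (asToCom 𝕜) (asToCom_single _ _)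
      (fun n hn => asToCom_injective (by omega)) asToCom_surjective (com_truncRec 𝕜 hk)
  have pois_com : ∀ k, 0 < k → k ≤ 2 → OperadIso ((Pois 𝕜).modTrunc k) (Com 𝕜).toOperad :=
    fun k hk hk' => UnitaryOperad.modTrunc_iso (P := Pois 𝕜) (Q := Com 𝕜) poisToCom rfl
      (fun n hn => poisToCom_injective (by omega)) poisToCom_surjective (com_truncRec 𝕜 hk)
  have h1_com : ∀ {P : Operad 𝕜}, OperadIso P (Com 𝕜).toOperad → Subsingleton P.H1 := by
    intro P h
    obtain ⟨e⟩ := h.h1_equiv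
    have := com_h1 𝕜
    exact e.toEquiv.subsingleton
  have a1 := as_com 1 (by omega) (by omega)
  have a2 := as_com 2 (by omega) (by omega)
  have p1 := pois_com 1 (by omega) (by omega)
  have p2 := pois_com 2 (by omega) (by omega)
  refine ⟨⟨⟨a1.trans p1.symm, p1.trans a2.symm, a2.trans p2.symm, p2⟩, h1_com a1, h1_com p1,
    h1_com a2, h1_com p2, com_h1 𝕜⟩, fun hchar => ?_, fun hchar h => ?_, fun k hk h => ?_⟩
  · have h2 : (2 : 𝕜) ≠ 0 := Ring.two_ne_zero hchar
    -- The weight `1/2` makes the commutator `xy - yx` correspond to the bracket of `Alt`.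
    have hc : (2 : 𝕜) * 2⁻¹ = 1 := mul_inv_cancel₀ h2
    have a3 : OperadIso ((As 𝕜).modTrunc 3) (Alt 𝕜).toOperad :=
      modTrunc_three_iso (asToAlt 2⁻¹)
        ((asToAlt_single _ _ _).trans (Prod.ext rfl (Subsingleton.elim (α := altForm 𝕜 0) _ _)))
        (fun n hn => asToAlt_injective hc hn) (asToAlt_two_surjective hc)
    have p3 : OperadIso ((Pois 𝕜).modTrunc 3) (Alt 𝕜).toOperad :=
      modTrunc_three_iso (P := Pois 𝕜) (poisToAlt 𝕜) rfl
        (fun n hn => poisToAlt_injective hn) poisToAlt_two_surjective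
    obtain ⟨e⟩ := alt_h1 h2
    obtain ⟨ea⟩ := a3.h1_equiv
    obtain ⟨ep⟩ := p3.h1_equiv
    exact ⟨a3.trans p3.symm, ⟨ea.trans e⟩, ⟨ep.trans e⟩⟩
  · obtain ⟨x, u, hu, hx, -⟩ := exists_as_product le_rfl h
    obtain ⟨a, rfl⟩ := as_two_comm x hx
    obtain ⟨c, hc⟩ := as_two_unital a u hu
    have : CharP 𝕜 2 := ringChar.of_eq hchar
    have h2 : (2 : 𝕜) = 0 := CharTwo.two_eq_zero
    rw [h2, zero_mul, zero_mul] at hc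
    exact zero_ne_one hc
  · obtain ⟨x, u, hu, hx, hassoc⟩ := exists_as_product (by omega) h
    obtain ⟨a, rfl⟩ := as_two_comm x hx
    obtain ⟨c, hc⟩ := as_two_unital a u hu
    have ha := as_anticommutator_assoc a (hassoc hk)
    -- Over a field `2a² = 0` means `2a = 0` or `a = 0`, and either contradicts `2ac = 1`.
    rcases mul_eq_zero.mp ha with h0 | h0
    · rw [h0, zero_mul] at hc
      exact zero_ne_one hc
    · rw [h0, mul_zero, zero_mul] at hc
      exact zero_ne_one hc
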